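/- **Thoma parameters and the Vershik–Kerov spaces.** Let $\alpha_1\ge\alpha_2\ge\dots\ge0$ and $\beta_1\ge\beta_2\ge\dots\ge0$ satisfy $\sum_i\alpha_i+\sum_i\beta_i\le1$, and put $\gamma=1-\sum_i\alpha_i-\sum_i\beta_i$. Let $\mathcal X=\mathbb N_+\sqcup\mathbb N_-\sqcup[0,\gamma]$ carry the probability measure $m$ that gives mass $\alpha_i$ to the $i$-th positive letter, mass $\beta_i$ to the $i$-th negative letter, and is Lebesgue measure on $[0,\gamma]$. Put $a(z)=\alpha_i$, $a(z)=-\beta_i$ and $a(z)=0$ when $z$ is the $i$-th positive letter, the $i$-th negative letter and a point of $[0,\gamma]$, respectively (with $a(z)^0=1$). For $x,y\in\mathcal X^n$ write $x\sim y$ if $y$ is a rearrangement of $x$, and let $V_n$ be the Hilbert space of functions $h$ on $\{(x,y):x\sim y\}$ with norm $$\|h\|^2=\int_{\mathcal X^n}\sum_{y\sim x}|h(x,y)|^2\,dm^{n}(x).$$ The symmetric group acts on $V_n$ by $(U_n(\sigma)h)(x,y)=(-1)^{\mathrm{inv}(\sigma,x)}h(\sigma^{-1}x,y)$, where $(\sigma^{-1}x)_i=x_{\sigma(i)}$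 and $\mathrm{inv}(\sigma,x)$ is the number of pairs $p<q$ with $x_p,x_q\in\mathbb N_-$ and $\sigma^{-1}(p)>\sigma^{-1}(q)$. For $k\ge0$ let $j_n^{(k)}:V_n\to V_{n+1}$, $$(j_n^{(k)}h)(x,y)=\delta(x_{n+1},y_{n+1})\,a(x_{n+1})^k\,h(x_1\cdots x_n,y_1\cdots y_n).$$ **Fock space.** Let $H$ be a complex Hilbert space with orthonormal basis $(e_c)$. The Bożejko–Guta Fock space is $\mathcal F=\bigoplus_{n\ge0}\frac1{n!}V_n\otimes_sH^{\otimes n}$. Here $V_n\otimes_sH^{\otimes n}$ is the space of vectors of $V_n\otimes H^{\otimes n}$ that are invariant under the diagonal action of the symmetric group (which on $H^{\otimes n}$ permutes the tensor factors), the inner product of the $n$-th summand is multiplied by $1/n!$, and $v\otimes_s\eta$ denotes the average of the orbit of $v\otimes\eta$. Let $\Omega=1\in V_0=\mathbb C$, let $R_c^{(k)}$ be the weighted creation operator $$R^{(k)}_c\,(v\otimes_s\eta)=(n+1)\,(j_n^{(k)}v)\otimes_s(\eta\otimes e_c),\qquad v\in V_n,\ \eta\in H^{\otimes n},$$ let $R_c^{(k)*}$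 be its adjoint, both acting on finite particle vectors, and let $\rho(X)=\langle\Omega,X\Omega\rangle$. **Dyck words and their digraphs.** Let $\varepsilon_1,\dots,\varepsilon_{2n}\in\{*,1\}$, let $i_1,\dots,i_{2n}$ be basis indices ("colours") and let $k_1,\dots,k_{2n}\in\mathbb N_0$. Assume that the word $R_{i_1}^{(k_1)\varepsilon_1}\cdots R_{i_{2n}}^{(k_{2n})\varepsilon_{2n}}$ is a multidimensional Dyck word: for every colour $c$, every initial segment contains at least as many annihilators ($\varepsilon=*$) of colour $c$ as creators ($\varepsilon=1$) of colour $c$, and the two numbers agree for the whole word. Let $p(1)<\dots<p(n)$ be the positions of the annihilators. Let $\Gamma$ be the digraph (loops allowed) with vertices $v_1,\dots,v_n$ and an edge from $v_r$ to $v_s$ if and only if $i_{p(r)}=i_{\pi(p(s))}$ and $\pi(p(s))>p(r)$, where $\pi$ is the noncrossing pair partition described in the theorem. Let $\Gamma_w$ be $\Gamma$ with vertex weights $w(v_r)=k_{p(r)}+1+k_{\pi(p(r))}$. **Cycle indicator polynomial.** The cycle-path indicator polynomial of a weighted digraph is $$I(\Gamma_w;\mathbf x,\mathbf y)=\sum_{(C,P)}\prod_{\kappa\in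 C}x_{w(\kappa)}\prod_{\lambda\in P}y_{w(\lambda)},$$ summed over all covers of the vertex set by disjoint directed cycles (the set $C$; loops are cycles of length one) and directed paths (the set $P$; single vertices are paths), where the weight of a cycle or path is the sum of the weights of its vertices. The cycle indicator polynomial is $I_c(\Gamma_w;\mathbf x)=I(\Gamma_w;\mathbf x,\mathbf 0)$. **Theorem.** There is exactly one noncrossing pair partition $\pi$ of $\{1,\dots,2n\}$ whose left points are precisely the positions $j$ with $\varepsilon_j=*$ (regarded as an involution, so that $\pi(p)$ is the partner of $p$), and with this $\pi$ $$\rho\bigl(R_{i_1}^{(k_1)\varepsilon_1}R_{i_2}^{(k_2)\varepsilon_2}\cdots R_{i_{2n}}^{(k_{2n})\varepsilon_{2n}}\bigr)=I_c(\Gamma_w;\mathbf x),$$ where $x_1=1$ and $x_m=\sum_i\alpha_i^m+(-1)^{m+1}\sum_i\beta_i^m$ for $m\ge2$. -/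

import Mathlib

open MeasureTheory
open scoped ENNReal InnerProductSpace

namespace ThomaFock

/-- The parameters of a Thoma character: two nonincreasing sequences of nonnegative numbers
with total sum at most one. -/
structure ThomaParam where
  α : ℕ → ℝ
  β : ℕ → ℝ
  α_nonneg : ∀ i, 0 ≤ α i
  β_nonneg : ∀ i, 0 ≤ β i
  α_antitone : Antitone α
  β_antitone : Antitone β
  α_summable : Summable α
  β_summable : Summable β
  sum_le_one : (∑' i, α i) + ∑' i, β i ≤ 1

/-- The mass of the continuous part. -/
noncomputable def ThomaParam.γ (t : ThomaParam) : ℝ := 1 - (∑' i, t.α i) - ∑' i, t.β i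

/-- The alphabet `ℕ₊ ⊔ ℕ₋ ⊔ ℝ` of the Vershik–Kerov construction: positive letters `inl i`,
negative letters `inr (inl i)`, continuous letters `inr (inr s)`. -/
abbrev Letter : Type := ℕ ⊕ (ℕ ⊕ ℝ)

/-- The probability measure on the alphabet: mass `α i` on the `i`-th positive letter, mass `β i` on
the `i`-th negative letter and Lebesgue measure on the interval `[0, γ]`. -/
noncomputable def letterMeasure (t : ThomaParam) : Measure Letter :=
  (Measure.sum fun i => ENNReal.ofReal (t.α i) • Measure.dirac (Sum.inl i)) +
  (Measure.sum fun i => ENNReal.ofReal (t.β i) • Measure.dirac (Sum.inr (Sum.inl i))) +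
  (volume.restrict (Set.Icc 0 t.γ)).map fun s => Sum.inr (Sum.inr s)

instance (t : ThomaParam) : IsProbabilityMeasure (letterMeasure t) := by
  have hm : Measurable (fun s : ℝ => (Sum.inr (Sum.inr s) : Letter)) :=
    measurable_inr.comp measurable_inr
  have hγ : 0 ≤ t.γ := by have := t.sum_le_one; unfold ThomaParam.γ; linarith
  constructor
  simp only [letterMeasure, Measure.coe_add, Pi.add_apply,
    Measure.sum_apply _ MeasurableSet.univ, Measure.smul_apply, measure_univ, smul_eq_mul, mul_one,
    Measure.map_apply hm MeasurableSet.univ, Set.preimage_univ, Measure.restrict_apply_univ,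
    Real.volume_Icc, sub_zero]
  rw [← ENNReal.ofReal_tsum_of_nonneg t.α_nonneg t.α_summable,
    ← ENNReal.ofReal_tsum_of_nonneg t.β_nonneg t.β_summable,
    ← ENNReal.ofReal_add (tsum_nonneg t.α_nonneg) (tsum_nonneg t.β_nonneg),
    ← ENNReal.ofReal_add (add_nonneg (tsum_nonneg t.α_nonneg) (tsum_nonneg t.β_nonneg)) hγ]
  simp [ThomaParam.γ]

instance : MeasurableEq Letter := by
  let ψ : Letter → ℝ × ℝ :=
    Sum.elim (fun n => ((0 : ℝ), (n : ℝ))) (Sum.elim (fun n => ((1 : ℝ), (n : ℝ))) fun s => (2, s))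
  have hψ : Measurable ψ := by
    refine Measurable.sumElim (measurable_of_countable _) (Measurable.sumElim
      (measurable_of_countable _) ?_)
    fun_prop
  have hinj : Function.Injective ψ := by
    rintro (a | a | a) (b | b | b) h <;> simp_all [ψ]
  constructor
  have h : Set.diagonal Letter = {p : Letter × Letter | ψ p.1 = ψ p.2} := by
    ext p; simp [hinj.eq_iff]
  rw [h]
  exact measurableSet_eq_fun (hψ.comp measurable_fst) (hψ.comp measurable_snd)

instance : MeasurableSingletonClass Letter := by
  constructor
  intro a
  exact measurableSet_eq_fun measurable_id measurable_const

/-- The weight `a(z)` of a letter: `α i`, `-β i`, and `0` on the three parts of the alphabet. -/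
def letterWeight (t : ThomaParam) : Letter → ℝ :=
  Sum.elim t.α (Sum.elim (fun i => -t.β i) fun _ => 0)

theorem measurable_letterWeight (t : ThomaParam) : Measurable (letterWeight t) :=
  Measurable.sumElim (measurable_of_countable _)
    (Measurable.sumElim (measurable_of_countable _) measurable_const)

theorem abs_letterWeight_le (t : ThomaParam) (z : Letter) : |letterWeight t z| ≤ 1 := by
  have hs := t.sum_le_one
  have hα : 0 ≤ ∑' i, t.α i := tsum_nonneg t.α_nonneg
  have hβ : 0 ≤ ∑' i, t.β i := tsum_nonneg t.β_nonneg
  rcases z with i | i | s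
  · have := t.α_summable.le_tsum i fun j _ => t.α_nonneg j
    simp only [letterWeight, Sum.elim_inl, abs_of_nonneg (t.α_nonneg i)]
    linarith
  · have := t.β_summable.le_tsum i fun j _ => t.β_nonneg j
    simp only [letterWeight, Sum.elim_inl, Sum.elim_inr, abs_neg, abs_of_nonneg (t.β_nonneg i)]
    linarith
  · simp [letterWeight]

/-- The negative letters. -/
def IsNeg (z : Letter) : Prop := ∃ i : ℕ, z = Sum.inr (Sum.inl i)

/-- Words of length `n`. -/
abbrev Word (n : ℕ) : Type := Fin n → Letter

/-- The product measure on words of length `n`. -/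
noncomputable def wordMeasure (t : ThomaParam) (n : ℕ) : Measure (Word n) :=
  Measure.pi fun _ => letterMeasure t

instance (t : ThomaParam) (n : ℕ) : IsProbabilityMeasure (wordMeasure t n) := by
  unfold wordMeasure; infer_instance

open Classical in
/-- The finite set of the rearrangements of the word `x`, that is, of all `y` with `y ∼ x`. -/
noncomputable def rearr {n : ℕ} (x : Word n) : Finset (Word n) :=
  Finset.univ.image fun σ : Equiv.Perm (Fin n) => x ∘ σ

/-- The measure on the pairs `(x, y)` with `x ∼ y` for which
`∫ F = ∫ ∑_{y ∼ x} F (x, y) dm(x)`. -/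
noncomputable def pairMeasure (t : ThomaParam) (n : ℕ) : Measure (Word n × Word n) :=
  (wordMeasure t n).bind fun x => ∑ y ∈ rearr x, Measure.dirac (x, y)

theorem mem_rearr {n : ℕ} {x y : Word n} :
    y ∈ rearr x ↔ ∃ σ : Equiv.Perm (Fin n), x ∘ σ = y := by
  simp [rearr]

theorem rearr_comp {n : ℕ} (x : Word n) (σ : Equiv.Perm (Fin n)) : rearr (x ∘ σ) = rearr x := by
  ext y
  simp only [mem_rearr]
  constructor
  · rintro ⟨τ, rfl⟩; exact ⟨σ * τ, rfl⟩
  · rintro ⟨τ, rfl⟩; exact ⟨σ⁻¹ * τ, by ext i; simp⟩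

theorem measurable_comp_perm {n : ℕ} (σ : Equiv.Perm (Fin n)) :
    Measurable fun x : Word n => x ∘ σ :=
  measurable_pi_lambda _ fun i => measurable_pi_apply (σ i)

theorem measurable_sum_rearr {n : ℕ} {F : Word n × Word n → ℝ≥0∞} (hF : Measurable F) :
    Measurable fun x => ∑ y ∈ rearr x, F (x, y) := by
  classical
  let N : Word n → ℝ≥0∞ := fun x =>
    ∑ σ : Equiv.Perm (Fin n), Set.indicator {x : Word n | x ∘ σ = x} 1 x
  have hNm : Measurable N := by
    refine Finset.measurable_sum _ fun σ _ => measurable_one.indicator ?_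
    have : {x : Word n | x ∘ σ = x} = ⋂ i, {x : Word n | x (σ i) = x i} := by
      ext x; simp [funext_iff]
    rw [this]
    exact MeasurableSet.iInter fun i =>
      measurableSet_eq_fun (measurable_pi_apply _) (measurable_pi_apply _)
  have hN : ∀ x, N x = (Finset.univ.filter fun σ : Equiv.Perm (Fin n) => x ∘ σ = x).card := by
    intro x
    simp [N, Set.indicator_apply]
  have hN0 : ∀ x, N x ≠ 0 := by
    intro x
    rw [hN]
    simp only [ne_eq, Nat.cast_eq_zero, Finset.card_eq_zero]
    exact Finset.ne_empty_of_mem (a := 1) (by simp)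
  have hNt : ∀ x, N x ≠ ∞ := by intro x; rw [hN]; simp
  have key : ∀ x, ∑ y ∈ rearr x, F (x, y) =
      (∑ σ : Equiv.Perm (Fin n), F (x, x ∘ σ)) / N x := by
    intro x
    rw [ENNReal.eq_div_iff (hN0 x) (hNt x), rearr,
      Finset.sum_comp (fun y => F (x, y)) fun σ : Equiv.Perm (Fin n) => x ∘ σ, Finset.mul_sum]
    refine Finset.sum_congr rfl fun y hy => ?_
    obtain ⟨τ, -, rfl⟩ := Finset.mem_image.1 hy
    rw [hN, nsmul_eq_mul]
    congr 2
    refine Finset.card_bij (fun σ _ => σ * τ) ?_ ?_ ?_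
    · intro σ hσ
      simp only [Finset.mem_filter, Finset.mem_univ, true_and] at hσ ⊢
      rw [Equiv.Perm.coe_mul, ← Function.comp_assoc, hσ]
    · intro σ _ σ' _ h; exact mul_right_cancel h
    · intro σ hσ
      simp only [Finset.mem_filter, Finset.mem_univ, true_and] at hσ
      refine ⟨σ * τ⁻¹, ?_, by simp⟩
      simp only [Finset.mem_filter, Finset.mem_univ, true_and]
      rw [Equiv.Perm.coe_mul, ← Function.comp_assoc, hσ]
      ext i; simp
  simp_rw [key]
  refine Measurable.div (Finset.measurable_sum _ fun σ _ => hF.comp ?_) hNm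
  exact measurable_id.prodMk (measurable_comp_perm σ)

theorem lintegral_pairMeasure (t : ThomaParam) {n : ℕ} {F : Word n × Word n → ℝ≥0∞}
    (hF : Measurable F) :
    ∫⁻ p, F p ∂pairMeasure t n = ∫⁻ x, ∑ y ∈ rearr x, F (x, y) ∂wordMeasure t n := by
  have hk : Measurable fun x : Word n => ∑ y ∈ rearr x, Measure.dirac (x, y) := by
    refine Measure.measurable_of_measurable_coe _ fun s hs => ?_
    have := measurable_sum_rearr (n := n) (F := s.indicator 1) (measurable_one.indicator hs)
    convert this using 2 with x
    simp [Measure.finsetSum_apply, Measure.dirac_apply' _ hs]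
  rw [pairMeasure, Measure.lintegral_bind hk.aemeasurable hF.aemeasurable]
  refine lintegral_congr fun x => ?_
  rw [lintegral_finsetSum_measure]
  exact Finset.sum_congr rfl fun y _ => lintegral_dirac' _ hF

theorem measurePreserving_comp_perm (t : ThomaParam) {n : ℕ} (σ : Equiv.Perm (Fin n)) :
    MeasurePreserving (fun x : Word n => x ∘ σ) (wordMeasure t n) (wordMeasure t n) := by
  exact measurePreserving_arrowCongr' (fun _ : Fin n => letterMeasure t)
    (fun _ : Fin n => letterMeasure t) σ⁻¹ (MeasurableEquiv.refl Letter)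
    (fun _ => MeasurePreserving.id (letterMeasure t))

theorem pairMeasure_apply (t : ThomaParam) {n : ℕ} {A : Set (Word n × Word n)}
    (hA : MeasurableSet A) :
    pairMeasure t n A = ∫⁻ x, ∑ y ∈ rearr x, A.indicator 1 (x, y) ∂wordMeasure t n := by
  rw [← lintegral_indicator_one hA, lintegral_pairMeasure t (measurable_one.indicator hA)]

instance (t : ThomaParam) (n : ℕ) : IsFiniteMeasure (pairMeasure t n) := by
  constructor
  rw [pairMeasure_apply t MeasurableSet.univ]
  refine lt_of_le_of_lt (lintegral_mono (g := fun _ => (n.factorial : ℝ≥0∞)) fun x => ?_) ?_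
  · simp only [Set.indicator_univ, Pi.one_apply, Finset.sum_const, nsmul_eq_mul, mul_one]
    have : (rearr x).card ≤ n.factorial := by
      refine Finset.card_image_le.trans ?_
      simp [Fintype.card_perm]
    exact_mod_cast this
  · simp

theorem measurePreserving_pair_perm (t : ThomaParam) {n : ℕ} (σ : Equiv.Perm (Fin n)) :
    MeasurePreserving (fun p : Word n × Word n => (p.1 ∘ σ, p.2)) (pairMeasure t n)
      (pairMeasure t n) := by
  have hm : Measurable fun p : Word n × Word n => (p.1 ∘ σ, p.2) :=
    ((measurable_comp_perm σ).comp measurable_fst).prodMk measurable_snd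
  refine ⟨hm, ?_⟩
  ext A hA
  rw [Measure.map_apply hm hA, pairMeasure_apply t (hm hA), pairMeasure_apply t hA,
    ← (measurePreserving_comp_perm t σ).lintegral_comp
      (measurable_sum_rearr (measurable_one.indicator hA))]
  refine lintegral_congr fun x => ?_
  rw [rearr_comp]
  rfl

/-- The pairs of words of length `n + 1` with the same last letter. -/
def sameLast (n : ℕ) : Set (Word (n + 1) × Word (n + 1)) :=
  {p | p.1 (Fin.last n) = p.2 (Fin.last n)}

theorem measurableSet_sameLast (n : ℕ) : MeasurableSet (sameLast n) :=
  measurableSet_eq_fun ((measurable_pi_apply _).comp measurable_fst)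
    ((measurable_pi_apply _).comp measurable_snd)

/-- Delete the last letters of both words. -/
def dropLast (n : ℕ) (p : Word (n + 1) × Word (n + 1)) : Word n × Word n :=
  (Fin.init p.1, Fin.init p.2)

theorem measurable_init (n : ℕ) : Measurable fun x : Word (n + 1) => (Fin.init x : Word n) :=
  measurable_pi_lambda _ fun i => measurable_pi_apply (Fin.castSucc i)

theorem measurable_dropLast (n : ℕ) : Measurable (dropLast n) :=
  ((measurable_init n).comp measurable_fst).prodMk ((measurable_init n).comp measurable_snd)

theorem measurePreserving_init (t : ThomaParam) (n : ℕ) :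
    MeasurePreserving (fun x : Word (n + 1) => (Fin.init x : Word n)) (wordMeasure t (n + 1))
      (wordMeasure t n) := by
  have h := measurePreserving_piFinSuccAbove (fun _ : Fin (n + 1) => letterMeasure t) (Fin.last n)
  have h2 := (measurePreserving_snd (μ := letterMeasure t) (ν := wordMeasure t n)).comp h
  have he : (fun x : Word (n + 1) => (Fin.init x : Word n)) =
      Prod.snd ∘ MeasurableEquiv.piFinSuccAbove (fun _ => Letter) (Fin.last n) := by
    funext x
    ext i
    simp [Fin.init]
  rw [he]
  exact h2

/-- The permutation of `n + 1` points that fixes the last one and permutes the others by `σ`. -/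
def extendPerm {n : ℕ} (σ : Equiv.Perm (Fin n)) : Equiv.Perm (Fin (n + 1)) where
  toFun := Fin.lastCases (Fin.last n) fun i => (σ i).castSucc
  invFun := Fin.lastCases (Fin.last n) fun i => (σ⁻¹ i).castSucc
  left_inv i := by refine Fin.lastCases ?_ (fun j => ?_) i <;> simp
  right_inv i := by refine Fin.lastCases ?_ (fun j => ?_) i <;> simp

theorem rearr_init {n : ℕ} (x : Word (n + 1)) (y : Word n) :
    y ∈ rearr (Fin.init x : Word n) ↔
      (Fin.snoc y (x (Fin.last n)) : Word (n + 1)) ∈ rearr x := by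
  classical
  simp only [mem_rearr]
  constructor
  · rintro ⟨σ, rfl⟩
    refine ⟨extendPerm σ, ?_⟩
    ext i
    refine Fin.lastCases ?_ (fun j => ?_) i <;> simp [extendPerm, Fin.init]
  · rintro ⟨σ, hσ⟩
    have hlast : x (σ (Fin.last n)) = x (Fin.last n) := by
      have := congrFun hσ (Fin.last n); simpa using this
    let τ : Equiv.Perm (Fin (n + 1)) := Equiv.swap (σ (Fin.last n)) (Fin.last n) * σ
    have hτ : x ∘ τ = Fin.snoc y (x (Fin.last n)) := by
      rw [← hσ]
      funext i
      simp only [τ, Function.comp_apply, Equiv.Perm.mul_apply, Equiv.swap_apply_def]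
      split_ifs with h1 h2
      · rw [h1, hlast]
      · rw [h2, hlast]
      · rfl
    have hτl : τ (Fin.last n) = Fin.last n := by simp [τ]
    have hne : ∀ i : Fin n, τ i.castSucc ≠ Fin.last n := fun i h =>
      (Fin.castSucc_lt_last i).ne (τ.injective (h.trans hτl.symm))
    let f : Fin n → Fin n := fun i => (τ i.castSucc).castPred (hne i)
    have hf : Function.Injective f := by
      intro i j h
      have := Fin.castPred_inj.1 h
      exact Fin.castSucc_injective n (τ.injective this)
    refine ⟨Equiv.ofBijective f (Finite.injective_iff_bijective.1 hf), ?_⟩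
    funext i
    have := congrFun hτ i.castSucc
    simpa [f, Fin.init] using this

theorem measurePreserving_dropLast (t : ThomaParam) (n : ℕ) :
    MeasurePreserving (dropLast n) ((pairMeasure t (n + 1)).restrict (sameLast n))
      (pairMeasure t n) := by
  classical
  refine ⟨measurable_dropLast n, ?_⟩
  ext A hA
  have hm := measurable_dropLast n hA
  rw [Measure.map_apply (measurable_dropLast n) hA, Measure.restrict_apply hm,
    pairMeasure_apply t (hm.inter (measurableSet_sameLast n)), pairMeasure_apply t hA,
    ← (measurePreserving_init t n).lintegral_comp
      (measurable_sum_rearr (measurable_one.indicator hA))]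
  refine lintegral_congr fun x => ?_
  symm
  refine Finset.sum_of_injOn (fun y => (Fin.snoc y (x (Fin.last n)) : Word (n + 1))) ?_ ?_ ?_ ?_
  · intro y _ y' _ h
    have := congrArg (fun z : Word (n + 1) => (Fin.init z : Word n)) h
    simpa using this
  · intro y hy
    exact (rearr_init x y).1 hy
  · intro y hy hny
    refine Set.indicator_of_notMem ?_ _
    rintro ⟨-, h⟩
    simp only [sameLast, Set.mem_ofPred_eq] at h
    have hy' : (Fin.snoc (Fin.init y) (x (Fin.last n)) : Word (n + 1)) = y := by
      rw [h]; exact Fin.snoc_init_self y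
    exact hny ⟨Fin.init y, (rearr_init x _).2 (by rw [hy']; exact hy), hy'⟩
  · intro y _
    simp [Set.indicator_apply, dropLast, sameLast]

section WeightedComp

variable {A B : Type*} [MeasurableSpace A] [MeasurableSpace B] {μ : Measure A} {ν : Measure B}

theorem memLp_weightedComp {S : Set A} {T : A → B} {g : A → ℂ} (hS : MeasurableSet S)
    (hT : MeasurePreserving T (μ.restrict S) ν) (hg : Measurable g) (hb : ∀ a, ‖g a‖ ≤ 1)
    {f : B → ℂ} (hf : MemLp f 2 ν) : MemLp (S.indicator fun a => g a * f (T a)) 2 μ := by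
  rw [memLp_indicator_iff_restrict hS]
  have h1 := hf.comp_measurePreserving hT
  exact h1.of_le (hg.aestronglyMeasurable.mul h1.1) (Filter.Eventually.of_forall fun a => by
    simpa using mul_le_of_le_one_left (norm_nonneg _) (hb a))

/-- The operator `f ↦ 1_S · g · (f ∘ T)` between `L²` spaces, where `|g| ≤ 1` and `T` preserves the
measure on `S`. -/
noncomputable def weightedComp (S : Set A) (T : A → B) (g : A → ℂ) (hS : MeasurableSet S)
    (hT : MeasurePreserving T (μ.restrict S) ν) (hg : Measurable g) (hb : ∀ a, ‖g a‖ ≤ 1) :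
    Lp ℂ 2 ν →L[ℂ] Lp ℂ 2 μ :=
  LinearMap.mkContinuous
    { toFun := fun f => (memLp_weightedComp hS hT hg hb (Lp.memLp f)).toLp _
      map_add' := fun f f' => by
        rw [← MemLp.toLp_add (memLp_weightedComp hS hT hg hb (Lp.memLp f))
          (memLp_weightedComp hS hT hg hb (Lp.memLp f'))]
        refine MemLp.toLp_congr _ _ ?_
        have h := ae_restrict_iff' hS |>.1 (hT.quasiMeasurePreserving.ae (Lp.coeFn_add f f'))
        filter_upwards [h] with a ha
        by_cases haS : a ∈ S
        · have h3 := ha haS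
          simp only [Pi.add_apply] at h3
          simp only [Set.indicator_of_mem haS, Pi.add_apply]
          rw [h3, mul_add]
        · simp [haS]
      map_smul' := fun c f => by
        rw [RingHom.id_apply,
          ← MemLp.toLp_const_smul c (memLp_weightedComp hS hT hg hb (Lp.memLp f))]
        refine MemLp.toLp_congr _ _ ?_
        have h := ae_restrict_iff' hS |>.1 (hT.quasiMeasurePreserving.ae (Lp.coeFn_smul c f))
        filter_upwards [h] with a ha
        by_cases haS : a ∈ S
        · have h3 := ha haS
          simp only [Pi.smul_apply] at h3
          simp only [Set.indicator_of_mem haS, Pi.smul_apply]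
          rw [h3, smul_eq_mul, smul_eq_mul, mul_left_comm]
        · simp [haS] }
    1 fun f => by
      simp only [LinearMap.coe_mk, AddHom.coe_mk, one_mul]
      rw [Lp.norm_toLp, Lp.norm_def]
      refine ENNReal.toReal_mono (Lp.eLpNorm_ne_top f) ?_
      rw [eLpNorm_indicator_eq_eLpNorm_restrict hS, ← eLpNorm_comp_measurePreserving
        (Lp.aestronglyMeasurable f) hT]
      exact eLpNorm_mono fun a => by
        simpa using mul_le_of_le_one_left (norm_nonneg _) (hb a)

theorem coeFn_weightedComp {S : Set A} {T : A → B} {g : A → ℂ} (hS : MeasurableSet S)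
    (hT : MeasurePreserving T (μ.restrict S) ν) (hg : Measurable g) (hb : ∀ a, ‖g a‖ ≤ 1)
    (f : Lp ℂ 2 ν) :
    weightedComp S T g hS hT hg hb f =ᵐ[μ] S.indicator fun a => g a * f (T a) :=
  MemLp.coeFn_toLp (memLp_weightedComp hS hT hg hb (Lp.memLp f))

end WeightedComp

theorem measurableSet_isNeg : MeasurableSet {z | IsNeg z} := by
  refine Set.Countable.measurableSet ?_
  have : {z | IsNeg z} = Set.range fun i : ℕ => (Sum.inr (Sum.inl i) : Letter) := by
    ext z; simp [IsNeg, eq_comm]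
  rw [this]
  exact Set.countable_range _

open Classical in
/-- `(-1)` to the number of the inversions of `σ⁻¹` among the positions of the negative letters
of `x`. -/
noncomputable def koszulSign {n : ℕ} (σ : Equiv.Perm (Fin n)) (x : Word n) : ℂ :=
  ∏ p, ∏ q, if p < q ∧ σ⁻¹ q < σ⁻¹ p ∧ IsNeg (x p) ∧ IsNeg (x q) then -1 else 1

theorem measurable_koszulSign {n : ℕ} (σ : Equiv.Perm (Fin n)) :
    Measurable (koszulSign σ : Word n → ℂ) := by
  classical
  refine Finset.measurable_prod _ fun p _ => Finset.measurable_prod _ fun q _ => ?_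
  refine Measurable.ite ?_ measurable_const measurable_const
  have hn : ∀ p : Fin n, MeasurableSet {x : Word n | IsNeg (x p)} := fun p =>
    (measurable_pi_apply p : Measurable fun x : Word n => x p) measurableSet_isNeg
  exact (MeasurableSet.const _).inter ((MeasurableSet.const _).inter ((hn p).inter (hn q)))

theorem norm_koszulSign {n : ℕ} (σ : Equiv.Perm (Fin n)) (x : Word n) :
    ‖koszulSign σ x‖ ≤ 1 := by
  classical
  rw [koszulSign, norm_prod]
  refine (Finset.prod_eq_one fun p _ => ?_).le
  rw [norm_prod]
  refine Finset.prod_eq_one fun q _ => ?_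
  split_ifs <;> simp

/-- `1` if `p < q` and `-1` otherwise. -/
noncomputable def ordSign {n : ℕ} (p q : Fin n) : ℂ := if p < q then 1 else -1

theorem ordSign_mul_self {n : ℕ} (p q : Fin n) : ordSign p q * ordSign p q = 1 := by
  unfold ordSign; split_ifs <;> simp

theorem ordSign_swap {n : ℕ} {p q : Fin n} (h : p ≠ q) : ordSign q p = -ordSign p q := by
  rcases h.lt_or_gt with h' | h' <;> simp [ordSign, h', h'.not_gt]

open Classical in
theorem koszulSign_eq {n : ℕ} (σ : Equiv.Perm (Fin n)) (x : Word n) :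
    koszulSign σ x = ∏ e ∈ Finset.univ.filter (fun e : Fin n × Fin n => e.1 < e.2),
      if IsNeg (x e.1) ∧ IsNeg (x e.2) then
        ordSign e.1 e.2 * ordSign (σ⁻¹ e.1) (σ⁻¹ e.2) else 1 := by
  rw [koszulSign, ← Fintype.prod_prod_type', Finset.prod_filter]
  refine Finset.prod_congr rfl fun e _ => ?_
  obtain ⟨p, q⟩ := e
  dsimp only
  by_cases h : p < q
  · have hne : σ⁻¹ p ≠ σ⁻¹ q := fun h' => h.ne (σ⁻¹.injective h')
    generalize σ⁻¹ p = p' at *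
    generalize σ⁻¹ q = q' at *
    rcases hne.lt_or_gt with h' | h'
    · simp [ordSign, h, h', h'.not_gt]
    · simp [ordSign, h, h', h'.not_gt]
  · simp [h]

theorem koszulSign_mul {n : ℕ} (τ σ : Equiv.Perm (Fin n)) (x : Word n) :
    koszulSign (τ * σ) x = koszulSign τ x * koszulSign σ (x ∘ τ) := by
  classical
  let F : Fin n × Fin n → ℂ := fun e =>
    if IsNeg (x (τ e.1)) ∧ IsNeg (x (τ e.2)) then
      ordSign e.1 e.2 * ordSign (σ⁻¹ e.1) (σ⁻¹ e.2) else 1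
  have hF : ∀ p q, p ≠ q → F (q, p) = F (p, q) := by
    intro p q h
    have h' : σ⁻¹ p ≠ σ⁻¹ q := fun h' => h (σ⁻¹.injective h')
    simp only [F, ordSign_swap h, ordSign_swap h', neg_mul_neg, and_comm]
  have h1 : koszulSign σ (x ∘ τ) =
      ∏ e ∈ Finset.univ.filter (fun e : Fin n × Fin n => e.1 < e.2), F (τ⁻¹ e.1, τ⁻¹ e.2) := by
    rw [koszulSign_eq]
    let m : Equiv.Perm (Fin n) → Fin n × Fin n → Fin n × Fin n := fun τ e =>
      if τ e.1 < τ e.2 then (τ e.1, τ e.2) else (τ e.2, τ e.1)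
    have hm : ∀ (τ : Equiv.Perm (Fin n)) (e : Fin n × Fin n), e.1 < e.2 →
        (m τ e).1 < (m τ e).2 := by
      intro τ e h
      have hne : τ e.1 ≠ τ e.2 := fun h' => h.ne (τ.injective h')
      rcases hne.lt_or_gt with h' | h' <;> simp [m, h', h'.not_gt]
    have hmm : ∀ (τ : Equiv.Perm (Fin n)) (e : Fin n × Fin n), e.1 < e.2 →
        m τ⁻¹ (m τ e) = e := by
      intro τ e h
      have hne : τ e.1 ≠ τ e.2 := fun h' => h.ne (τ.injective h')
      rcases hne.lt_or_gt with h' | h' <;> simp [m, h', h'.not_gt, h, h.not_gt]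
    refine Finset.prod_bij' (fun e _ => m τ e) (fun e _ => m τ⁻¹ e) ?_ ?_ ?_ ?_ ?_
    · intro e he; simpa using hm τ e (by simpa using he)
    · intro e he; simpa using hm τ⁻¹ e (by simpa using he)
    · intro e he; exact hmm τ e (by simpa using he)
    · intro e he; simpa using hmm τ⁻¹ e (by simpa using he)
    · intro e he
      have h : e.1 < e.2 := by simpa using he
      have hne : τ e.1 ≠ τ e.2 := fun h' => h.ne (τ.injective h')
      rcases hne.lt_or_gt with h' | h'
      · simp [m, h', F]
      · simp only [m, h'.not_gt, if_false]
        rw [hF _ _ (fun h' => hne (τ⁻¹.injective h'))]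
        simp [F]
  rw [h1, koszulSign_eq, koszulSign_eq, ← Finset.prod_mul_distrib]
  refine Finset.prod_congr rfl fun e _ => ?_
  have e1 : τ (τ⁻¹ e.1) = e.1 := τ.apply_symm_apply _
  have e2 : τ (τ⁻¹ e.2) = e.2 := τ.apply_symm_apply _
  simp only [F, e1, e2, mul_inv_rev, Equiv.Perm.mul_apply]
  by_cases h : IsNeg (x e.1) ∧ IsNeg (x e.2)
  · simp only [if_pos h]
    have := ordSign_mul_self (τ⁻¹ e.1) (τ⁻¹ e.2)
    linear_combination (-(ordSign e.1 e.2 * ordSign (σ⁻¹ (τ⁻¹ e.1)) (σ⁻¹ (τ⁻¹ e.2)))) * this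
  · simp only [if_neg h, mul_one]

theorem koszulSign_one {n : ℕ} (x : Word n) : koszulSign 1 x = 1 := by
  classical
  rw [koszulSign]
  refine Finset.prod_eq_one fun p _ => Finset.prod_eq_one fun q _ => if_neg ?_
  rintro ⟨h, h', -⟩
  exact absurd h' (by simpa using h.le)

/-- The Hilbert space `V_n` of the square integrable functions on the pairs `x ∼ y`. -/
abbrev V (t : ThomaParam) (n : ℕ) : Type := Lp ℂ 2 (pairMeasure t n)

/-- The action of the symmetric group on `V_n`, `(U σ h)(x, y) = ± h (σ⁻¹ x, y)` where
`σ⁻¹ x = x ∘ σ`; the sign counts the inversions among the negative letters. -/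
noncomputable def U (t : ThomaParam) {n : ℕ} (σ : Equiv.Perm (Fin n)) : V t n →L[ℂ] V t n :=
  weightedComp Set.univ (fun p => (p.1 ∘ σ, p.2)) (fun p => koszulSign σ p.1) MeasurableSet.univ
    (by rw [Measure.restrict_univ]; exact measurePreserving_pair_perm t σ)
    ((measurable_koszulSign σ).comp measurable_fst) fun _ => norm_koszulSign _ _

theorem coeFn_U (t : ThomaParam) {n : ℕ} (σ : Equiv.Perm (Fin n)) (h : V t n) :
    U t σ h =ᵐ[pairMeasure t n] fun p => koszulSign σ p.1 * h (p.1 ∘ σ, p.2) := by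
  refine (coeFn_weightedComp _ _ _ _ h).trans ?_
  rw [Set.indicator_univ]

theorem U_one (t : ThomaParam) (n : ℕ) (h : V t n) : U t 1 h = h := by
  refine Lp.ext ((coeFn_U t 1 h).trans (Filter.Eventually.of_forall fun p => ?_))
  simp [koszulSign_one]

theorem U_mul (t : ThomaParam) {n : ℕ} (τ σ : Equiv.Perm (Fin n)) (h : V t n) :
    U t (τ * σ) h = U t τ (U t σ h) := by
  refine Lp.ext ?_
  have h1 := (measurePreserving_pair_perm t τ).quasiMeasurePreserving.ae (coeFn_U t σ h)
  filter_upwards [coeFn_U t (τ * σ) h, coeFn_U t τ (U t σ h), h1] with p h2 h3 h4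
  rw [h2, h3, h4, koszulSign_mul, mul_assoc]
  rfl

/-- The weighted embedding `V_n → V_{n+1}`,
`(j h)(x, y) = δ(x_{n+1}, y_{n+1}) a(x_{n+1})^k h(x_1 ⋯ x_n, y_1 ⋯ y_n)`. -/
noncomputable def j (t : ThomaParam) (k n : ℕ) : V t n →L[ℂ] V t (n + 1) :=
  weightedComp (sameLast n) (dropLast n)
    (fun p => ((letterWeight t (p.1 (Fin.last n)) ^ k : ℝ) : ℂ))
    (measurableSet_sameLast n) (measurePreserving_dropLast t n)
    (Complex.measurable_ofReal.comp (((measurable_letterWeight t).comp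
      ((measurable_pi_apply _).comp measurable_fst)).pow_const k))
    fun p => by
      rw [Complex.norm_real, Real.norm_eq_abs, abs_pow]
      exact pow_le_one₀ (abs_nonneg _) (abs_letterWeight_le t _)

theorem coeFn_j (t : ThomaParam) (k n : ℕ) (h : V t n) :
    j t k n h =ᵐ[pairMeasure t (n + 1)] (sameLast n).indicator fun p =>
      ((letterWeight t (p.1 (Fin.last n)) ^ k : ℝ) : ℂ) * h (dropLast n p) :=
  coeFn_weightedComp _ _ _ _ h

section TensorMap

variable {A B : Type*} {E F : Type*} [NormedAddCommGroup E] [InnerProductSpace ℂ E]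
  [NormedAddCommGroup F] [InnerProductSpace ℂ F]

theorem norm_extend_rpow {r : A → B} (hr : Function.Injective r) {F : Type*}
    [NormedAddCommGroup F] (g : A → F) :
    (fun b => ‖Function.extend r g 0 b‖ ^ (2 : ℝ≥0∞).toReal) =
      Function.extend r (fun a => ‖g a‖ ^ (2 : ℝ≥0∞).toReal) 0 := by
  funext b
  by_cases hb : ∃ a, r a = b
  · obtain ⟨a, rfl⟩ := hb
    simp [hr.extend_apply]
  · rw [Function.extend_apply' _ _ _ hb, Function.extend_apply' _ _ _ hb]
    simp

theorem summable_norm_map (T : E →L[ℂ] F) (f : lp (fun _ : A => E) 2) :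
    Summable (fun a => ‖T (f a)‖ ^ (2 : ℝ≥0∞).toReal) ∧
      ∑' a, ‖T (f a)‖ ^ (2 : ℝ≥0∞).toReal ≤ (‖T‖ * ‖f‖) ^ (2 : ℝ≥0∞).toReal := by
  have h2 : (0 : ℝ) < (2 : ℝ≥0∞).toReal := by norm_num
  have hs := ((lp.memℓp f).summable h2).mul_left (‖T‖ ^ (2 : ℝ≥0∞).toReal)
  have hle : ∀ a, ‖T (f a)‖ ^ (2 : ℝ≥0∞).toReal ≤
      ‖T‖ ^ (2 : ℝ≥0∞).toReal * ‖f a‖ ^ (2 : ℝ≥0∞).toReal := fun a => by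
    rw [← Real.mul_rpow (norm_nonneg _) (norm_nonneg _)]
    exact Real.rpow_le_rpow (norm_nonneg _) (T.le_opNorm _) h2.le
  have hs' := Summable.of_nonneg_of_le (fun a => by positivity) hle hs
  refine ⟨hs', (hs'.tsum_le_tsum hle hs).trans ?_⟩
  rw [tsum_mul_left, Real.mul_rpow (norm_nonneg _) (norm_nonneg _), lp.norm_rpow_eq_tsum h2]

theorem memlp_extend {r : A → B} (hr : Function.Injective r) (T : E →L[ℂ] F)
    (f : lp (fun _ : A => E) 2) : Memℓp (Function.extend r (fun a => T (f a)) 0) 2 := by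
  have h2 : (0 : ℝ) < (2 : ℝ≥0∞).toReal := by norm_num
  rw [memℓp_gen_iff h2, norm_extend_rpow hr, summable_extend_zero hr]
  exact (summable_norm_map T f).1

/-- For an injective map `r` of index sets, the bounded operator `v ⊗ e_a ↦ T v ⊗ e_{r a}` from
`E ⊗ ℓ²(A) = ℓ²(A; E)` to `F ⊗ ℓ²(B) = ℓ²(B; F)`. -/
noncomputable def tensorMap (r : A → B) (hr : Function.Injective r) (T : E →L[ℂ] F) :
    lp (fun _ : A => E) 2 →L[ℂ] lp (fun _ : B => F) 2 :=
  LinearMap.mkContinuous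
    { toFun := fun f => ⟨Function.extend r (fun a => T (f a)) 0, memlp_extend hr T f⟩
      map_add' := fun f g => by
        ext b
        simp only [lp.coeFn_add, Pi.add_apply]
        by_cases hb : ∃ a, r a = b
        · obtain ⟨a, rfl⟩ := hb
          simp only [hr.extend_apply, map_add]
        · simp only [Function.extend_apply' _ _ _ hb, Pi.zero_apply, add_zero]
      map_smul' := fun c f => by
        ext b
        simp only [lp.coeFn_smul, Pi.smul_apply, RingHom.id_apply]
        by_cases hb : ∃ a, r a = b
        · obtain ⟨a, rfl⟩ := hb
          simp only [hr.extend_apply, map_smul]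
        · simp only [Function.extend_apply' _ _ _ hb, Pi.zero_apply, smul_zero] }
    ‖T‖ fun f => by
      have h2 : (0 : ℝ) < (2 : ℝ≥0∞).toReal := by norm_num
      refine lp.norm_le_of_tsum_le h2 (by positivity) ?_
      change ∑' b, ‖Function.extend r (fun a => T (f a)) 0 b‖ ^ (2 : ℝ≥0∞).toReal ≤ _
      rw [norm_extend_rpow hr, tsum_extend_zero hr]
      exact (summable_norm_map T f).2

theorem tensorMap_apply (r : A → B) (hr : Function.Injective r) (T : E →L[ℂ] F)
    (f : lp (fun _ : A => E) 2) (a : A) : tensorMap r hr T f (r a) = T (f a) := by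
  change Function.extend r (fun a => T (f a)) 0 (r a) = T (f a)
  rw [hr.extend_apply]

end TensorMap

/-- The Hilbert space `V_n ⊗ H^{⊗n}`, where `H = ℓ²(ι)` with its standard orthonormal basis
`(e_a)` indexed by `ι`: since `H^{⊗n} = ℓ²(ι^n)`, it is `ℓ²(ι^n; V_n)`. -/
abbrev VTensor (t : ThomaParam) (ι : Type*) (n : ℕ) : Type _ :=
  lp (fun _ : Fin n → ι => V t n) 2

/-- The diagonal action of the symmetric group on `V_n ⊗ H^{⊗n}`,
`v ⊗ e_{c 1} ⊗ ⋯ ⊗ e_{c n} ↦ U σ v ⊗ e_{c (σ⁻¹ 1)} ⊗ ⋯ ⊗ e_{c (σ⁻¹ n)}`. -/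
noncomputable def permOp (t : ThomaParam) (ι : Type*) {n : ℕ} (σ : Equiv.Perm (Fin n)) :
    VTensor t ι n →L[ℂ] VTensor t ι n :=
  tensorMap (fun c : Fin n → ι => c ∘ ⇑σ⁻¹) σ⁻¹.surjective.injective_comp_right (U t σ)

theorem permOp_apply (t : ThomaParam) {ι : Type*} {n : ℕ} (σ : Equiv.Perm (Fin n))
    (f : VTensor t ι n) (c : Fin n → ι) : permOp t ι σ f c = U t σ (f (c ∘ σ)) := by
  have h := tensorMap_apply (fun c : Fin n → ι => c ∘ ⇑σ⁻¹) σ⁻¹.surjective.injective_comp_right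
    (U t σ) f (c ∘ σ)
  have hc : (c ∘ σ) ∘ ⇑σ⁻¹ = c := by
    funext i; exact congrArg c (σ.apply_symm_apply i)
  rw [← h]
  simp only [hc]
  rfl

theorem permOp_mul (t : ThomaParam) {ι : Type*} {n : ℕ} (τ σ : Equiv.Perm (Fin n))
    (f : VTensor t ι n) : permOp t ι (τ * σ) f = permOp t ι τ (permOp t ι σ f) := by
  ext1
  funext c
  rw [permOp_apply, permOp_apply, permOp_apply, U_mul]
  rfl

/-- The symmetrizator `P_n = (n!)⁻¹ ∑_σ U σ ⊗ Ũ σ`. -/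
noncomputable def symmetrizator (t : ThomaParam) (ι : Type*) (n : ℕ) :
    VTensor t ι n →L[ℂ] VTensor t ι n :=
  (n.factorial : ℂ)⁻¹ • ∑ σ : Equiv.Perm (Fin n), permOp t ι σ

/-- The space `V_n ⊗_s H^{⊗n}` of the invariant vectors. -/
noncomputable def symSpace (t : ThomaParam) (ι : Type*) (n : ℕ) : Submodule ℂ (VTensor t ι n) :=
  ⨅ σ : Equiv.Perm (Fin n), LinearMap.ker
    (permOp t ι σ - ContinuousLinearMap.id ℂ (VTensor t ι n)).toLinearMap

theorem mem_symSpace {t : ThomaParam} {ι : Type*} {n : ℕ} {f : VTensor t ι n} :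
    f ∈ symSpace t ι n ↔ ∀ σ, permOp t ι σ f = f := by
  simp [symSpace, sub_eq_zero]

instance (t : ThomaParam) (ι : Type*) (n : ℕ) : CompleteSpace (symSpace t ι n) := by
  suffices h : IsClosed (symSpace t ι n : Set (VTensor t ι n)) from h.completeSpace_coe
  rw [symSpace, Submodule.coe_iInf]
  exact isClosed_iInter fun σ => ContinuousLinearMap.isClosed_ker _

theorem symmetrizator_mem (t : ThomaParam) (ι : Type*) (n : ℕ) (f : VTensor t ι n) :
    symmetrizator t ι n f ∈ symSpace t ι n := by
  rw [mem_symSpace]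
  intro τ
  simp only [symmetrizator, smul_apply, sum_apply,
    map_smul, map_sum]
  congr 1
  simp only [← permOp_mul]
  exact Fintype.sum_equiv (Equiv.mulLeft τ) _ _ fun σ => rfl

theorem snoc_injective_left {ι : Type*} (n : ℕ) (a : ι) :
    Function.Injective fun c : Fin n → ι => (Fin.snoc c a : Fin (n + 1) → ι) := by
  intro c c' h
  have := congrArg (fun z : Fin (n + 1) → ι => (Fin.init z : Fin n → ι)) h
  simpa using this

/-- The weighted right creation operator `R^{(k)}(e_a)` on the `n`-particle space,
`v ⊗_s η ↦ (n + 1) (j^{(k)} v) ⊗_s (η ⊗ e_a)`. -/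
noncomputable def creationLevel (t : ThomaParam) {ι : Type*} (k : ℕ) (a : ι) (n : ℕ) :
    symSpace t ι n →L[ℂ] symSpace t ι (n + 1) :=
  ((n + 1 : ℕ) : ℂ) •
    ((symmetrizator t ι (n + 1) ∘L
      tensorMap (fun c : Fin n → ι => (Fin.snoc c a : Fin (n + 1) → ι)) (snoc_injective_left n a)
        (j t k n) ∘L (symSpace t ι n).subtypeL).codRestrict (symSpace t ι (n + 1))
      fun _ => symmetrizator_mem t ι (n + 1) _)

/-- The finite particle vectors of the Fock space `⨁ₙ (n!)⁻¹ V_n ⊗_s H^{⊗n}`: the algebraic direct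
sum of the (complete) `n`-particle spaces. It is dense in the Fock space and is the common invariant
domain of the (unbounded) creation and annihilation operators, so that words in these operators are
composed here. -/
abbrev Fock (t : ThomaParam) (ι : Type*) : Type _ := DirectSum ℕ fun n => symSpace t ι n

/-- The inner product of the Fock space, in which the one of the `n`-particle space is scaled
by `(n!)⁻¹`. -/
noncomputable def fockInner {t : ThomaParam} {ι : Type*} (f g : Fock t ι) : ℂ :=
  ∑ᶠ n : ℕ, (n.factorial : ℂ)⁻¹ * ⟪f n, g n⟫_ℂ

/-- The weighted annihilation operator on the `(n + 1)`-particle space. It is the adjoint of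
`creationLevel` with respect to the scaled inner products: the factor `(n + 1)⁻¹ = n! / (n + 1)!`
accounts for the scaling. -/
noncomputable def annihilationLevel (t : ThomaParam) {ι : Type*} (k : ℕ) (a : ι) (n : ℕ) :
    symSpace t ι (n + 1) →L[ℂ] symSpace t ι n :=
  ((n + 1 : ℕ) : ℂ)⁻¹ • ContinuousLinearMap.adjoint (creationLevel t k a n)

section Graded

variable {M : ℕ → Type*} [∀ n, AddCommGroup (M n)] [∀ n, Module ℂ (M n)]

/-- The operator of degree `1` on a graded space with the given components. -/
noncomputable def raise (R : ∀ n, M n →ₗ[ℂ] M (n + 1)) : Module.End ℂ (DirectSum ℕ M) :=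
  DirectSum.toModule ℂ ℕ _ fun n => DirectSum.lof ℂ ℕ M (n + 1) ∘ₗ R n

/-- The operator of degree `-1` on a graded space with the given components, zero on `M 0`. -/
noncomputable def lower (R : ∀ n, M (n + 1) →ₗ[ℂ] M n) : Module.End ℂ (DirectSum ℕ M) :=
  DirectSum.toModule ℂ ℕ _ fun
    | 0 => 0
    | n + 1 => DirectSum.lof ℂ ℕ M n ∘ₗ R n

theorem raise_zero (R : ∀ n, M n →ₗ[ℂ] M (n + 1)) (f : DirectSum ℕ M) : raise R f 0 = 0 := by
  induction f using DirectSum.induction_on with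
  | zero => simp
  | of n v =>
    rw [← DirectSum.lof_eq_of ℂ, raise, DirectSum.toModule_lof]
    exact DirectSum.of_eq_of_ne _ _ _ (by simp)
  | add f g hf hg => rw [map_add, DirectSum.add_apply, hf, hg, add_zero]

theorem raise_succ (R : ∀ n, M n →ₗ[ℂ] M (n + 1)) (f : DirectSum ℕ M) (n : ℕ) :
    raise R f (n + 1) = R n (f n) := by
  induction f using DirectSum.induction_on with
  | zero => simp
  | of m v =>
    rw [← DirectSum.lof_eq_of ℂ, raise, DirectSum.toModule_lof]
    by_cases h : m = n
    · subst h
      simp [DirectSum.lof_apply]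
    · rw [LinearMap.comp_apply, DirectSum.lof_eq_of, DirectSum.lof_eq_of,
        DirectSum.of_eq_of_ne _ _ _ (by omega), DirectSum.of_eq_of_ne _ _ _ (by omega), map_zero]
  | add f g hf hg => simp only [map_add, DirectSum.add_apply, hf, hg]

theorem lower_apply (R : ∀ n, M (n + 1) →ₗ[ℂ] M n) (f : DirectSum ℕ M) (n : ℕ) :
    lower R f n = R n (f (n + 1)) := by
  induction f using DirectSum.induction_on with
  | zero => simp
  | of m v =>
    rw [← DirectSum.lof_eq_of ℂ, lower, DirectSum.toModule_lof]
    rcases m with _ | m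
    · rw [DirectSum.lof_eq_of, DirectSum.of_eq_of_ne _ _ _ (by omega)]
      simp
    · by_cases h : m = n
      · subst h
        simp [DirectSum.lof_apply]
      · simp only [LinearMap.comp_apply]
        rw [DirectSum.lof_eq_of, DirectSum.lof_eq_of,
          DirectSum.of_eq_of_ne _ _ _ (by omega), DirectSum.of_eq_of_ne _ _ _ (by omega), map_zero]
  | add f g hf hg => simp only [map_add, DirectSum.add_apply, hf, hg]

end Graded

/-- The weighted creation operator `R^{(k)}(e_a)`. -/
noncomputable def creation (t : ThomaParam) {ι : Type*} (k : ℕ) (a : ι) :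
    Module.End ℂ (Fock t ι) :=
  raise fun n => (creationLevel t k a n).toLinearMap

/-- The weighted annihilation operator `R^{(k)}(e_a)^*`, the adjoint of the weighted creation
operator with respect to the inner product `fockInner`, see `fockInner_creation`. -/
noncomputable def annihilation (t : ThomaParam) {ι : Type*} (k : ℕ) (a : ι) :
    Module.End ℂ (Fock t ι) :=
  lower fun n => (annihilationLevel t k a n).toLinearMap

theorem inner_smul_adjoint {E F : Type*} [NormedAddCommGroup E] [InnerProductSpace ℂ E]
    [CompleteSpace E] [NormedAddCommGroup F] [InnerProductSpace ℂ F] [CompleteSpace F]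
    (T : E →L[ℂ] F) (c : ℂ) (x : E) (y : F) :
    ⟪x, (c • ContinuousLinearMap.adjoint T) y⟫_ℂ = c * ⟪T x, y⟫_ℂ := by
  rw [smul_apply, inner_smul_right, ContinuousLinearMap.adjoint_inner_right]

/-- The annihilation operators are the adjoints of the creation operators. -/
theorem fockInner_creation (t : ThomaParam) {ι : Type*} (k : ℕ) (a : ι) (f g : Fock t ι) :
    fockInner (creation t k a f) g = fockInner f (annihilation t k a g) := by
  classical
  obtain ⟨N, hN⟩ : ∃ N, ∀ n, N ≤ n → f n = 0 := by
    refine ⟨(DFinsupp.support f).sup id + 1, fun n hn => ?_⟩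
    by_contra h
    have := Finset.le_sup (f := id) (DFinsupp.mem_support_iff.2 h)
    simp only [id] at this
    omega
  have h0 : creation t k a f 0 = 0 := raise_zero _ f
  have h1 : ∀ n, creation t k a f (n + 1) = creationLevel t k a n (f n) := raise_succ _ f
  have h2 : ∀ n, annihilation t k a g n = annihilationLevel t k a n (g (n + 1)) :=
    lower_apply _ g
  have e1 : fockInner (creation t k a f) g = ∑ n ∈ Finset.range (N + 1),
      (n.factorial : ℂ)⁻¹ * ⟪creation t k a f n, g n⟫_ℂ := by
    refine finsum_eq_sum_of_support_subset _ fun n hn => ?_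
    by_contra h
    have h' : N + 1 ≤ n := by
      simpa only [Finset.coe_range, Set.mem_Iio, not_lt] using h
    obtain ⟨m, rfl⟩ : ∃ m, n = m + 1 := ⟨n - 1, by omega⟩
    refine hn ?_
    beta_reduce
    rw [h1, hN m (by omega), map_zero, inner_zero_left, mul_zero]
  have e2 : fockInner f (annihilation t k a g) = ∑ n ∈ Finset.range N,
      (n.factorial : ℂ)⁻¹ * ⟪f n, annihilation t k a g n⟫_ℂ := by
    refine finsum_eq_sum_of_support_subset _ fun n hn => ?_
    by_contra h
    have h' : N ≤ n := by
      simpa only [Finset.coe_range, Set.mem_Iio, not_lt] using h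
    refine hn ?_
    beta_reduce
    rw [hN n h', inner_zero_left, mul_zero]
  rw [e1, e2, Finset.sum_range_succ', h0, inner_zero_left, mul_zero, add_zero]
  refine Finset.sum_congr rfl fun n _ => ?_
  rw [h1, h2, annihilationLevel, inner_smul_adjoint, Nat.factorial_succ, Nat.cast_mul, mul_inv]
  ring

open Classical in
/-- The vacuum vector: the constant function `1` in `V_0`. -/
noncomputable def vacuum (t : ThomaParam) (ι : Type*) : Fock t ι :=
  DirectSum.lof ℂ ℕ (fun n => symSpace t ι n) 0
    ⟨lp.single 2 Fin.elim0 (indicatorConstLp 2 MeasurableSet.univ (measure_ne_top _ _) 1), by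
      rw [mem_symSpace]
      intro σ
      ext1
      funext c
      obtain rfl : σ = 1 := Subsingleton.elim _ _
      rw [permOp_apply, U_one]
      rfl⟩

/-- The vacuum expectation `ρ(X) = ⟨Ω, X Ω⟩`. -/
noncomputable def vacuumExpectation {t : ThomaParam} {ι : Type*} (X : Module.End ℂ (Fock t ι)) :
    ℂ :=
  fockInner (vacuum t ι) (X (vacuum t ι))

section Words

variable {ι : Type*} {n : ℕ}

/-- The word `R_{i_1}^{(k_1) ε_1} ⋯ R_{i_{2n}}^{(k_{2n}) ε_{2n}}` as an operator; here `ε j = true`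
stands for the exponent `*` (annihilator) and `ε j = false` for the exponent `1` (creator). -/
noncomputable def wordOp (t : ThomaParam) (ε : Fin (2 * n) → Bool) (i : Fin (2 * n) → ι)
    (k : Fin (2 * n) → ℕ) : Module.End ℂ (Fock t ι) :=
  (List.ofFn fun j => if ε j = true then annihilation t (k j) (i j)
    else creation t (k j) (i j)).prod

open Classical in
/-- The coordinate in direction `a` of the lattice path of a word after its first `m` letters:
annihilators of colour `a` are up steps and creators of colour `a` are down steps. -/
noncomputable def height (ε : Fin (2 * n) → Bool) (i : Fin (2 * n) → ι) (a : ι) (m : ℕ) : ℤ :=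
  ∑ j ∈ Finset.univ.filter (fun j : Fin (2 * n) => j.val < m ∧ i j = a),
    if ε j = true then 1 else -1

/-- Multidimensional Dyck words: all coordinates of the lattice path stay nonnegative and return
to zero. -/
def IsDyckWord (ε : Fin (2 * n) → Bool) (i : Fin (2 * n) → ι) : Prop :=
  ∀ a : ι, (∀ m ≤ 2 * n, 0 ≤ height ε i a m) ∧ height ε i a (2 * n) = 0

/-- `π` is a noncrossing pair partition of the positions, regarded as a fixed point free
involution, whose left points are exactly the positions of the annihilators. -/
structure IsNoncrossingPairing (ε : Fin (2 * n) → Bool) (π : Equiv.Perm (Fin (2 * n))) : Prop where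
  involutive : ∀ p, π (π p) = p
  ne_self : ∀ p, π p ≠ p
  left_iff : ∀ p, ε p = true ↔ p < π p
  noncrossing : ∀ p q, ¬(p < q ∧ q < π p ∧ π p < π q)

/-- The positions of the annihilators, which are the vertices of the digraph of a word. -/
abbrev Annihilators (ε : Fin (2 * n) → Bool) : Type := {p : Fin (2 * n) // ε p = true}

/-- The digraph of a word: there is an edge from `r` to `s` if the annihilator at `r` and the
creator at `π s` have the same colour and `π s > r`. -/
def wordDigraph (ε : Fin (2 * n) → Bool) (i : Fin (2 * n) → ι) (π : Equiv.Perm (Fin (2 * n))) :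
    Digraph (Annihilators ε) where
  Adj r s := i r = i (π s) ∧ r.val < π s

/-- The vertex weights `w(v) = k_p + 1 + k_{π p}`, where `p` is the position of `v`. -/
def wordWeight (ε : Fin (2 * n) → Bool) (k : Fin (2 * n) → ℕ) (π : Equiv.Perm (Fin (2 * n))) :
    Annihilators ε → ℕ :=
  fun v => k v + 1 + k (π v)

end Words

section CycleIndicator

variable {V : Type*} [Fintype V] [DecidableEq V]

/-- A cycle-path cover of a digraph: `C` is a set of directed cycles (loops are cycles with one
vertex), `P` is a set of directed paths (single vertices are paths of length `0`), both nonempty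
and without repeated vertices, such that every vertex lies on exactly one of them. -/
structure IsCyclePathCover (Γ : Digraph V) (C : Finset {c : Cycle V // c.Nodup})
    (P : Finset {l : List V // l.Nodup}) : Prop where
  cycle_ne : ∀ c ∈ C, c.val ≠ Cycle.nil
  cycle_chain : ∀ c ∈ C, c.val.Chain Γ.Adj
  path_ne : ∀ l ∈ P, l.val ≠ []
  path_chain : ∀ l ∈ P, l.val.IsChain Γ.Adj
  cover : ∀ v : V, (C.filter fun c => v ∈ c.val).card + (P.filter fun l => v ∈ l.val).card = 1

open Classical in
/-- The cycle-path indicator polynomial `I(Γ_w; x, y) = ∑_{(C, P)} ∏_{γ ∈ C} x_{w γ} ∏_{π ∈ P} y_{w π}`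
of a weighted digraph, in the variables `x_m = X (inl m)` and `y_m = X (inr m)`. -/
noncomputable def cyclePathIndicator (Γ : Digraph V) (w : V → ℕ) : MvPolynomial (ℕ ⊕ ℕ) ℤ :=
  ∑ e ∈ Finset.univ.filter (fun e : Finset {c : Cycle V // c.Nodup} ×
      Finset {l : List V // l.Nodup} => IsCyclePathCover Γ e.1 e.2),
    (∏ c ∈ e.1, MvPolynomial.X (Sum.inl (c.val.toMultiset.map w).sum)) *
      ∏ l ∈ e.2, MvPolynomial.X (Sum.inr (l.val.map w).sum)

/-- The cycle indicator polynomial `I_c(Γ_w; x) = I(Γ_w; x, 0)`. -/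
noncomputable def cycleIndicator (Γ : Digraph V) (w : V → ℕ) : MvPolynomial ℕ ℤ :=
  MvPolynomial.aeval (Sum.elim MvPolynomial.X 0) (cyclePathIndicator Γ w)

end CycleIndicator

/-- The values `x_1 = 1` and `x_m = ∑ α_i^m + (-1)^(m+1) ∑ β_i^m` for `m ≥ 2`. -/
noncomputable def thomaVariable (t : ThomaParam) (m : ℕ) : ℝ :=
  if m = 1 then 1 else (∑' i, t.α i ^ m) + (-1) ^ (m + 1) * ∑' i, t.β i ^ m

end ThomaFock

/-! Both sides satisfy the same recursion: one annihilator is processed at a time, and one vertex of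
the digraph is removed or contracted.

On the operator side, everything stays in the span of the symmetrized vectors built from `δ(x, y) ∏
a(x_i) ^ K_i ⊗ e_{c 1} ⊗ ⋯ ⊗ e_{c n}`, which are recorded by colours `c` and exponents `K`. A
creator appends one colour and one exponent. For an annihilator, the cosets of `S_n` in `S_{n+1}`
are represented by the transpositions with the last point (`bijective_extendPerm_mul_swap`), so it
acts by a sum over the particles (`annihilationLevel_symVec`). The last particle, if its colour
fits, is integrated out and gives the scalar `x_m` with `m = K_last + k + 1`, because `∫ a ^ (m - 1)
dm = x_m`. An earlier particle `i` of the right colour is removed by moving the last one into its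
place: the two letters are forced to be equal, the two exponents and `k` add up, and the mass of the
letter together with the sign of the transposition gives one more factor `a`.

On the combinatorial side, setting the path variables to zero leaves the covers by cycles alone.
These are the permutations all of whose arrows are edges (`aeval_cycleIndicator`). Expanding in the
image of one vertex `v` gives either a loop, hence a factor `x_{w(v)}`, or an edge from `v` to `s`;
in the second case `v` is merged into `s`, the weights are added, and the arrows into `s` are
replaced by those into `v` (`permSum_option`).

The two recursions are matched in `vacuum_prefixOp_fockVec`. The word acts from the right, and since
the pairing is noncrossing, the last particle present when an annihilator acts was created by the
partner of that annihilator. Loops correspond to removing this particle and other edges to the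
exchange terms. The pairing itself comes from first returns of the lattice path. -/

open MeasureTheory
open scoped ENNReal InnerProductSpace

namespace ThomaFock

/-! ### Sums over permutations weighted by cycles, and their contraction recursion -/

section PermSum

open Equiv

variable {R : Type*} [CommRing R] {V W : Type*}

theorem sameCycle_permCongr_apply (e : V ≃ W) (σ : Perm V) (u v : V) :
    (e.permCongr σ).SameCycle (e u) (e v) ↔ σ.SameCycle u v := by
  have h : ∀ n : ℤ, (e.permCongr σ) ^ n = e.permCongr (σ ^ n) := fun n =>
    (map_zpow e.permCongrHom σ n).symm
  simp only [Perm.SameCycle, h, Equiv.permCongr_apply, Equiv.symm_apply_apply,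
    EmbeddingLike.apply_eq_iff_eq]

/-- Checking single arrows suffices to compare the cycle partitions of two permutations, since on a
finite set points of one cycle are joined by nonnegative powers. -/
theorem sameCycle_of_map_apply {f : V → W} {σ : Perm V} {ρ : Perm W}
    (h : ∀ u, ρ.SameCycle (f u) (f (σ u))) [Finite V] {u v : V} (huv : σ.SameCycle u v) :
    ρ.SameCycle (f u) (f v) := by
  obtain ⟨n, -, rfl⟩ := huv.exists_pow_eq'
  induction n with
  | zero => exact Perm.SameCycle.refl _ _
  | succ n ih =>
    rw [pow_succ', Perm.mul_apply]
    exact (ih ⟨n, by simp⟩).trans (h _)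

variable [Fintype V] [Fintype W]

open Classical in
/-- The product over the cycles of a permutation, fixed points included, of the variables indexed
by the total weights of the cycles. -/
noncomputable def cycleProd (x : ℕ → R) (σ : Perm V) (w : V → ℕ) : R :=
  ∏ q : Quotient (Perm.SameCycle.setoid σ), x (∑ v with Quotient.mk _ v = q, w v)

open Classical in
/-- The sum of `cycleProd` over the permutations all of whose arrows are edges. -/
noncomputable def permSum [DecidableEq V] (x : ℕ → R) (Adj : V → V → Prop) (w : V → ℕ) : R :=
  ∑ σ : Perm V, if ∀ v, Adj v (σ v) then cycleProd x σ w else 0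

open Classical in
-- Any complete invariant of the cycles may index the product. This is used for relabelled and
-- contracted permutations, and for cycles given as lists.
theorem cycleProd_eq_prod {Q : Type*} [Fintype Q] (x : ℕ → R) (σ : Perm V) (w : V → ℕ)
    (f : V → Q) (hf : Function.Surjective f) (h : ∀ u v, f u = f v ↔ σ.SameCycle u v) :
    cycleProd x σ w = ∏ q, x (∑ v with f v = q, w v) := by
  let g : Quotient (Perm.SameCycle.setoid σ) → Q :=
    Quotient.lift f fun u v huv => (h u v).2 huv
  have hg : Function.Bijective g := by
    constructor
    · intro a b
      induction a using Quotient.inductionOn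
      induction b using Quotient.inductionOn
      intro hab
      exact Quotient.sound ((h _ _).1 hab)
    · intro q
      obtain ⟨v, rfl⟩ := hf q
      exact ⟨Quotient.mk _ v, rfl⟩
  refine Fintype.prod_bijective g hg _ _ fun q => ?_
  congr 2
  ext v
  simp only [Finset.mem_filter, Finset.mem_univ, true_and]
  rw [← hg.1.eq_iff]
  rfl

theorem cycleProd_congr (x : ℕ → R) (e : V ≃ W) (σ : Perm V) (w : W → ℕ) :
    cycleProd x (e.permCongr σ) w = cycleProd x σ (w ∘ e) := by
  classical
  rw [cycleProd, cycleProd_eq_prod x σ (w ∘ e)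
    (fun v => Quotient.mk (Perm.SameCycle.setoid (e.permCongr σ)) (e v))]
  · refine Finset.prod_congr rfl fun q _ => ?_
    congr 1
    rw [Finset.sum_filter, Finset.sum_filter]
    rw [← Equiv.sum_comp e]
    exact Finset.sum_congr rfl fun v _ => by congr
  · exact Quotient.mk_surjective.comp e.surjective
  · intro u v
    rw [Quotient.eq]
    exact sameCycle_permCongr_apply e σ u v

theorem permSum_congr [DecidableEq V] [DecidableEq W] (x : ℕ → R) (e : V ≃ W)
    {Adj : V → V → Prop} {Adj' : W → W → Prop} {w : V → ℕ} {w' : W → ℕ}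
    (hA : ∀ u v, Adj u v ↔ Adj' (e u) (e v)) (hw : ∀ v, w v = w' (e v)) :
    permSum x Adj w = permSum x Adj' w' := by
  classical
  refine Fintype.sum_equiv e.permCongr _ _ fun σ => ?_
  obtain rfl : w = w' ∘ e := funext hw
  rw [cycleProd_congr]
  refine if_congr ?_ rfl rfl
  simp only [hA, Equiv.permCongr_apply]
  exact ⟨fun h v => by simpa using h (e.symm v), fun h v => by simpa using h (e v)⟩

theorem permSum_of_isEmpty [DecidableEq V] [IsEmpty V] (x : ℕ → R) (Adj : V → V → Prop)
    (w : V → ℕ) :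
    permSum x Adj w = 1 := by
  classical
  simp only [permSum, cycleProd, IsEmpty.forall_iff, if_true]
  rw [Fintype.sum_unique]
  exact Fintype.prod_empty _

open Classical in
theorem cycleProd_optionCongr (x : ℕ → R) (ρ : Perm V) (w : Option V → ℕ) :
    cycleProd x (optionCongr ρ) w = x (w none) * cycleProd x ρ (w ∘ some) := by
  rw [cycleProd_eq_prod x (optionCongr ρ) w
    (Option.map (Quotient.mk (Perm.SameCycle.setoid ρ)))]
  · rw [Fintype.prod_option, cycleProd]
    congr 2
    · rw [Finset.sum_filter, Fintype.sum_option]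
      simp
    · funext q
      congr 1
      rw [Finset.sum_filter, Fintype.sum_option, Finset.sum_filter]
      simp
  · rintro (_ | q)
    · exact ⟨none, rfl⟩
    · obtain ⟨v, rfl⟩ := Quotient.mk_surjective q
      exact ⟨some v, rfl⟩
  · have h1 : ∀ u v : V, Perm.SameCycle (optionCongr ρ) (some u) (some v) ↔ ρ.SameCycle u v := by
      intro u v
      refine ⟨fun h => ?_, fun h => sameCycle_of_map_apply (f := some) (fun u => ⟨1, by simp⟩) h⟩
      refine sameCycle_of_map_apply (f := fun a => a.getD u) (ρ := ρ) ?_ h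
      rintro (_ | r)
      · exact Perm.SameCycle.refl _ _
      · exact ⟨1, rfl⟩
    have h0 : ∀ u : V, ¬Perm.SameCycle (optionCongr ρ) none (some u) := by
      rintro u ⟨n, hn⟩
      rw [Perm.zpow_apply_eq_self_of_apply_eq_self (by simp)] at hn
      exact absurd hn (by simp)
    rintro (_ | u) (_ | v)
    · simpa using Perm.SameCycle.refl _ _
    · simpa using h0 v
    · simpa [Perm.sameCycle_comm] using h0 u
    · rw [h1, Option.map_some, Option.map_some, Option.some_inj, Quotient.eq]
      rfl

/-- The permutation on the left is `ρ` with `none` inserted into the cycle of `s`, immediately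
before `s`. No cycle is created or split, so only the weight of that one cycle changes, and the
extra weight can be charged to `s`. -/
theorem cycleProd_swap_mul_optionCongr [DecidableEq V] (x : ℕ → R) (ρ : Perm V) (s : V)
    (w : Option V → ℕ) :
    cycleProd x (swap none (some s) * optionCongr ρ) w =
      cycleProd x ρ fun v => w (some v) + if v = s then w none else 0 := by
  classical
  set σ : Perm (Option V) := swap none (some s) * optionCongr ρ with hσ
  have h0 : σ none = some s := by simp [hσ]
  have h1 : ∀ r, ρ r = s → σ (some r) = none := by rintro r rfl; simp [hσ]
  have h2 : ∀ r, ρ r ≠ s → σ (some r) = some (ρ r) := by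
    intro r hr
    simp only [hσ, Perm.mul_apply, optionCongr_apply, Option.map_some]
    exact swap_apply_of_ne_of_ne (by simp) (by simpa using hr)
  -- This retraction identifies `none` with `s`; it induces the bijection between the cycles of the
  -- two permutations.
  let f : Option V → V := fun u => u.getD s
  have hf : ∀ u, ρ.SameCycle (f u) (f (σ u)) := by
    rintro (_ | r)
    · rw [h0]; exact Perm.SameCycle.refl _ _
    · by_cases hr : ρ r = s
      · rw [h1 r hr]; exact ⟨1, by simpa [f] using hr⟩
      · rw [h2 r hr]; exact ⟨1, by simp [f]⟩
  have hg : ∀ r, σ.SameCycle (some r) (some (ρ r)) := by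
    intro r
    by_cases hr : ρ r = s
    -- The exponent is two because the arrow of `ρ` into `s` has become a detour through `none`.
    · exact ⟨2, by rw [zpow_two, Perm.mul_apply, h1 r hr, h0, hr]⟩
    · exact ⟨1, by rw [zpow_one, h2 r hr]⟩
  have hfs : ∀ u, σ.SameCycle u (some (f u)) := by
    rintro (_ | r)
    · exact ⟨1, by simpa [f] using h0⟩
    · exact Perm.SameCycle.refl _ _
  rw [cycleProd_eq_prod x σ w (fun u => Quotient.mk (Perm.SameCycle.setoid ρ) (f u)), cycleProd]
  · refine Finset.prod_congr rfl fun q _ => ?_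
    congr 1
    rw [Finset.sum_filter, Finset.sum_filter, Fintype.sum_option]
    have : ∀ v : V, (if Quotient.mk (Perm.SameCycle.setoid ρ) v = q then
        (w (some v) + if v = s then w none else 0) else 0) =
        (if Quotient.mk (Perm.SameCycle.setoid ρ) v = q then w (some v) else 0) +
        if v = s then (if Quotient.mk (Perm.SameCycle.setoid ρ) s = q then w none else 0)
          else 0 := by
      intro v
      by_cases hv : v = s
      · subst hv; split_ifs <;> simp
      · split_ifs <;> simp
    simp only [this, Finset.sum_add_distrib, Finset.sum_ite_eq', Finset.mem_univ, if_true]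
    rw [add_comm]
    have e1 : ∀ v, f (some v) = v := fun _ => rfl
    have e0 : f none = s := rfl
    simp only [e1, e0]
  · exact fun q => by
      obtain ⟨v, rfl⟩ := Quotient.mk_surjective q
      exact ⟨some v, rfl⟩
  · intro u v
    rw [Quotient.eq]
    refine ⟨fun h => (hfs u).trans (Perm.SameCycle.trans ?_ (hfs v).symm), fun h =>
      sameCycle_of_map_apply hf h⟩
    exact sameCycle_of_map_apply hg h

open Classical in
/-- The expansion of `permSum` with respect to the image of one vertex, which is then contracted. -/
theorem permSum_option [DecidableEq V] (x : ℕ → R) (Adj : Option V → Option V → Prop)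
    (w : Option V → ℕ) :
    permSum x Adj w =
      (if Adj none none then
        x (w none) * permSum x (fun u v => Adj (some u) (some v)) (w ∘ some) else 0) +
      ∑ s : V, if Adj none (some s) then
        permSum x (fun u v => if v = s then Adj (some u) none else Adj (some u) (some v))
          (fun v => w (some v) + if v = s then w none else 0) else 0 := by
  -- A permutation of `Option V` amounts to the image of `none` together with a permutation `ρ` of
  -- `V`; it is recovered as `swap none a * optionCongr ρ`.
  rw [permSum, ← Equiv.sum_comp Perm.decomposeOption.symm, Fintype.sum_prod_type,
    Fintype.sum_option]
  congr 1
  · by_cases h : Adj none none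
    · rw [if_pos h, permSum, Finset.mul_sum]
      refine Finset.sum_congr rfl fun ρ _ => ?_
      rw [Perm.decomposeOption_symm_apply, swap_self, ← Perm.one_def, one_mul,
        cycleProd_optionCongr, mul_ite, mul_zero]
      refine if_congr ?_ rfl rfl
      simp [Option.forall, h]
    · rw [if_neg h]
      refine Finset.sum_eq_zero fun ρ _ => if_neg fun h' => h ?_
      simpa using h' none
  · refine Finset.sum_congr rfl fun s _ => ?_
    by_cases h : Adj none (some s)
    · rw [if_pos h, permSum]
      refine Finset.sum_congr rfl fun ρ _ => ?_
      -- The predecessor of `s` under `ρ` is sent to `none`, so the merged vertex inherits its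
      -- incoming edges from `none` and its outgoing edges from `s`.
      have key : (∀ v, Adj v (Perm.decomposeOption.symm (some s, ρ) v)) ↔
          ∀ v, if ρ v = s then Adj (some v) none else Adj (some v) (some (ρ v)) := by
        simp only [Perm.decomposeOption_symm_apply, Option.forall, Perm.mul_apply,
          optionCongr_apply, Option.map_none, swap_apply_left, h, true_and, Option.map_some]
        refine forall_congr' fun v => ?_
        by_cases hv : ρ v = s
        · simp [hv]
        · rw [if_neg hv, swap_apply_of_ne_of_ne (by simp) (by simpa using hv)]
      simp only [key]
      rw [Perm.decomposeOption_symm_apply, cycleProd_swap_mul_optionCongr]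
      congr
    · rw [if_neg h]
      refine Finset.sum_eq_zero fun ρ _ => if_neg fun h' => h ?_
      simpa using h' none

end PermSum

/-! ### Covers by directed cycles are permutations -/

section CycleCovers

variable {V : Type*}

/-- Indices modulo the length put the closing arrow on the same footing as the others. -/
theorem chain_coe_iff_getElem (r : V → V → Prop) (l : List V) :
    (l : Cycle V).Chain r ↔
      ∀ (i : ℕ) (hi : i < l.length),
        r l[i] (l[(i + 1) % l.length]'(Nat.mod_lt _ (i.zero_le.trans_lt hi))) := by
  rcases l with _ | ⟨a, l⟩
  · simp
  · rw [Cycle.chain_coe_cons, List.isChain_iff_getElem]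
    simp only [List.length_cons, List.length_append, List.length_nil]
    refine forall_congr' fun i => ⟨fun h hi => ?_, fun h hi => ?_⟩
    · have := h (by omega)
      rcases Nat.lt_or_ge (i + 1) (l.length + 1) with h1 | h1
      · simp only [Nat.mod_eq_of_lt h1]
        grind
      · obtain rfl : i = l.length := by omega
        simp only [Nat.mod_self]
        grind
    · have := h (by omega)
      rcases Nat.lt_or_ge (i + 1) (l.length + 1) with h1 | h1
      · simp only [Nat.mod_eq_of_lt h1] at this
        grind
      · obtain rfl : i = l.length := by omega
        simp only [Nat.mod_self] at this
        grind

theorem exists_mem_of_ne_nil {c : Cycle V} (h : c ≠ Cycle.nil) : ∃ v, v ∈ c := by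
  induction c using Cycle.induction_on with
  | nil => exact absurd rfl h
  | cons a l _ => exact ⟨a, by simp⟩

/-- The cycle of a permutation through a given point. -/
noncomputable def cycleThrough (σ : Equiv.Perm V) (v : V) : {c : Cycle V // c.Nodup} :=
  ⟨Function.periodicOrbit σ v, Function.nodup_periodicOrbit⟩

theorem self_mem_cycleThrough [Finite V] (σ : Equiv.Perm V) (v : V) : v ∈ (cycleThrough σ v).val :=
  Function.self_mem_periodicOrbit (σ.injective.mem_periodicPts v)

open Function in
-- Once the list is rotated to begin at `v`, the arrows force its entry number `k` to be the `k`-th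
-- iterate of `v`, and the absence of repetitions forces its length to be the minimal period.
theorem eq_periodicOrbit_of_chain {σ : Equiv.Perm V} {c : Cycle V} (hc : c.Nodup)
    (h : c.Chain fun u v => σ u = v) {v : V} (hv : v ∈ c) : c = periodicOrbit σ v := by
  induction c using Quotient.inductionOn' with
  | h l =>
    change (l : Cycle V) = _
    replace hc : l.Nodup := hc
    replace h : (l : Cycle V).Chain fun u v => σ u = v := h
    replace hv : v ∈ l := hv
    obtain ⟨i, hi, rfl⟩ := List.getElem_of_mem hv
    have hr : (l : Cycle V) = (l.rotate i : List V) :=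
      Quotient.sound ⟨i, rfl⟩
    set m := l.rotate i with hm
    have hlen : m.length = l.length := List.length_rotate ..
    have hmn : m.Nodup := List.nodup_rotate.2 hc
    have h0 : m[0] = l[i] := by
      simp only [hm, List.getElem_rotate, Nat.zero_add, Nat.mod_eq_of_lt hi]
    rw [hr, chain_coe_iff_getElem] at h
    have hpow : ∀ k (hk : k < m.length), m[k] = σ^[k] m[0] := by
      intro k
      induction k with
      | zero => intro _; rfl
      | succ k ih =>
        intro hk
        have := h k (by omega)
        simp only [Nat.mod_eq_of_lt hk] at this
        rw [← this, ih, iterate_succ_apply']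
    have hper : IsPeriodicPt σ m.length m[0] := by
      have := h (m.length - 1) (by omega)
      have e : m.length - 1 + 1 = m.length := by omega
      simp only [e, Nat.mod_self] at this
      rw [hpow _ (by omega), ← iterate_succ_apply' σ, Nat.succ_eq_add_one] at this
      simp only [e] at this
      exact this
    have hmin : minimalPeriod σ m[0] = m.length := by
      -- A smaller minimal period would make the first vertex occur again at that index, which the
      -- absence of repetitions excludes.
      refine le_antisymm (hper.minimalPeriod_le (by omega)) (not_lt.1 fun hlt => ?_)
      have h1 := hpow _ hlt
      rw [iterate_minimalPeriod] at h1
      have h2 := (List.Nodup.getElem_inj_iff hmn).1 h1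
      exact (hper.minimalPeriod_pos (by omega)).ne' h2
    rw [hr, ← h0, periodicOrbit_def, hmin]
    congr 1
    refine List.ext_getElem (by simp) fun k hk _ => ?_
    simp [hpow k hk]

variable [DecidableEq V]

theorem chain_iff_next (r : V → V → Prop) (c : Cycle V) (hc : c.Nodup) :
    c.Chain r ↔ ∀ v (hv : v ∈ c), r v (c.next hc v hv) := by
  induction c using Quotient.inductionOn' with
  | h l =>
    change (l : Cycle V).Chain r ↔ ∀ v (hv : v ∈ l), r v (l.next v hv)
    have hl : l.Nodup := hc
    rw [chain_coe_iff_getElem]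
    constructor
    · intro h v hv
      obtain ⟨i, hi, rfl⟩ := List.getElem_of_mem hv
      rw [List.next_getElem l hl i hi]
      exact h i hi
    · intro h i hi
      rw [← List.next_getElem l hl i hi]
      exact h _ _

variable [Fintype V]

open Classical in
/-- The cycles of a permutation, fixed points included. -/
noncomputable def permCycles (σ : Equiv.Perm V) : Finset {c : Cycle V // c.Nodup} :=
  Finset.univ.filter fun c => c.val ≠ Cycle.nil ∧ c.val.Chain fun u v => σ u = v

theorem mem_permCycles {σ : Equiv.Perm V} {c : {c : Cycle V // c.Nodup}} :
    c ∈ permCycles σ ↔ c.val ≠ Cycle.nil ∧ c.val.Chain fun u v => σ u = v := by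
  simp [permCycles]

theorem cycleThrough_mem (σ : Equiv.Perm V) (v : V) : cycleThrough σ v ∈ permCycles σ := by
  refine mem_permCycles.2 ⟨fun h => ?_, ?_⟩
  · have := self_mem_cycleThrough σ v
    rw [h] at this
    exact Cycle.notMem_nil v this
  · rw [cycleThrough, Function.periodicOrbit_chain]
    intro n _
    rw [Function.iterate_succ_apply']

theorem eq_cycleThrough {σ : Equiv.Perm V} {c : {c : Cycle V // c.Nodup}}
    (h : c ∈ permCycles σ) {v : V} (hv : v ∈ c.val) : c = cycleThrough σ v :=
  Subtype.ext (eq_periodicOrbit_of_chain c.2 (mem_permCycles.1 h).2 hv)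

theorem cycleThrough_eq_iff (σ : Equiv.Perm V) (u v : V) :
    cycleThrough σ u = cycleThrough σ v ↔ σ.SameCycle u v := by
  constructor
  · intro h
    have hu := self_mem_cycleThrough σ v
    rw [← h, cycleThrough, Function.mem_periodicOrbit_iff (σ.injective.mem_periodicPts u)] at hu
    obtain ⟨n, hn⟩ := hu
    exact ⟨n, by rw [zpow_natCast, ← hn, Equiv.Perm.iterate_eq_pow]⟩
  · intro h
    obtain ⟨n, -, rfl⟩ := h.exists_pow_eq'
    refine eq_cycleThrough (cycleThrough_mem σ u) ?_
    rw [cycleThrough, Function.mem_periodicOrbit_iff (σ.injective.mem_periodicPts u)]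
    exact ⟨n, by rw [Equiv.Perm.iterate_eq_pow]⟩

theorem isCyclePathCover_permCycles {Γ : Digraph V} {σ : Equiv.Perm V}
    (h : ∀ v, Γ.Adj v (σ v)) : IsCyclePathCover Γ (permCycles σ) ∅ where
  cycle_ne c hc := (mem_permCycles.1 hc).1
  cycle_chain c hc := Cycle.Chain.imp (fun u v (huv : σ u = v) => huv ▸ h u) (mem_permCycles.1 hc).2
  path_ne := by simp
  path_chain := by simp
  cover v := by
    rw [Finset.filter_empty, Finset.card_empty, add_zero, Finset.card_eq_one]
    refine ⟨cycleThrough σ v, ?_⟩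
    ext c
    rw [Finset.mem_filter, Finset.mem_singleton]
    constructor
    · rintro ⟨h1, h2⟩; exact eq_cycleThrough h1 h2
    · rintro rfl; exact ⟨cycleThrough_mem σ v, self_mem_cycleThrough σ v⟩

theorem apply_eq_next {σ : Equiv.Perm V} {c : {c : Cycle V // c.Nodup}}
    (h : c ∈ permCycles σ) {v : V} (hv : v ∈ c.val) : σ v = c.val.next c.2 v hv :=
  (chain_iff_next _ _ c.2).1 (mem_permCycles.1 h).2 v hv

/-- The image of `v` can be read off as the successor of `v` on its cycle. -/
theorem permCycles_injective : Function.Injective (permCycles : Equiv.Perm V → _) := by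
  intro σ ρ h
  ext v
  have h1 := cycleThrough_mem σ v
  have h2 := h1
  rw [h] at h2
  rw [apply_eq_next h1 (self_mem_cycleThrough σ v), apply_eq_next h2 (self_mem_cycleThrough σ v)]

/-- Without paths, every vertex lies on exactly one cycle of the cover, and the permutation sends it
to its successor there. -/
theorem exists_permCycles_eq {Γ : Digraph V} {C : Finset {c : Cycle V // c.Nodup}}
    (h : IsCyclePathCover Γ C ∅) : ∃ σ : Equiv.Perm V, (∀ v, Γ.Adj v (σ v)) ∧
      permCycles σ = C := by
  have hex : ∀ v : V, ∃ c, C.filter (fun c => v ∈ c.val) = {c} := fun v => by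
    have := h.cover v
    rw [Finset.filter_empty, Finset.card_empty, add_zero] at this
    exact Finset.card_eq_one.1 this
  choose g hg using hex
  have hg' : ∀ v c, (c ∈ C ∧ v ∈ c.val) ↔ c = g v := fun v c => by
    rw [← Finset.mem_singleton, ← hg, Finset.mem_filter]
  have hgm : ∀ v, v ∈ (g v).val := fun v => ((hg' v _).2 rfl).2
  have hgC : ∀ v, g v ∈ C := fun v => ((hg' v _).2 rfl).1
  let f : V → V := fun v => (g v).val.next (g v).2 v (hgm v)
  have hf : ∀ c ∈ C, ∀ v (hv : v ∈ c.val), f v = c.val.next c.2 v hv := by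
    intro c hc v hv
    obtain rfl := (hg' v c).1 ⟨hc, hv⟩
    rfl
  have hfm : ∀ v, f v ∈ (g v).val := fun v => Cycle.next_mem _ _ _ _
  have hinj : Function.Injective f := by
    intro u v huv
    have h1 : g u = g (f u) := (hg' _ _).1 ⟨hgC u, hfm u⟩
    have h2 : g v = g (f u) := (hg' _ _).1 ⟨hgC v, huv ▸ hfm v⟩
    have hv : v ∈ (g u).val := by rw [h1, ← h2]; exact hgm v
    have e1 := hf _ (hgC u) u (hgm u)
    have e2 := hf _ (hgC u) v hv
    rw [huv, e2] at e1
    -- Both points lie on the same cycle, where passing to the predecessor undoes `f`.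
    have := congrArg (fun z : {z // z ∈ (g u).val} => (g u).val.prev (g u).2 z.1 z.2)
      (Subtype.ext e1 : (⟨_, Cycle.next_mem _ (g u).2 v hv⟩ : {z // z ∈ (g u).val}) =
        ⟨_, Cycle.next_mem _ (g u).2 u (hgm u)⟩)
    simp only [Cycle.prev_next] at this
    exact this.symm
  let σ : Equiv.Perm V := Equiv.ofBijective f (Finite.injective_iff_bijective.1 hinj)
  have hσ : ∀ v, σ v = f v := fun _ => rfl
  have hsub : ∀ c ∈ C, c ∈ permCycles σ := fun c hc =>
    mem_permCycles.2 ⟨h.cycle_ne c hc, (chain_iff_next _ _ c.2).2 fun v hv => hf c hc v hv⟩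
  refine ⟨σ, fun v => ?_, ?_⟩
  · rw [hσ, hf _ (hgC v) v (hgm v)]
    exact (chain_iff_next _ _ (g v).2).1 (h.cycle_chain _ (hgC v)) v (hgm v)
  · refine Finset.Subset.antisymm (fun c hc => ?_) hsub
    obtain ⟨v, hv⟩ := exists_mem_of_ne_nil (mem_permCycles.1 hc).1
    rw [eq_cycleThrough hc hv, ← eq_cycleThrough (hsub _ (hgC v)) (hgm v)]
    exact hgC v

theorem sum_map_toMultiset (c : Cycle V) (hc : c.Nodup) (w : V → ℕ) :
    (c.toMultiset.map w).sum = ∑ v with v ∈ c, w v := by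
  induction c using Quotient.inductionOn' with
  | h l =>
    change ((l : Multiset V).map w).sum = ∑ v with v ∈ l, w v
    have hl : l.Nodup := hc
    rw [Multiset.map_coe, Multiset.sum_coe, ← List.sum_toFinset w hl]
    congr 1
    ext v
    simp

theorem prod_permCycles {R : Type*} [CommRing R] (x : ℕ → R) (σ : Equiv.Perm V) (w : V → ℕ) :
    ∏ c ∈ permCycles σ, x (c.val.toMultiset.map w).sum = cycleProd x σ w := by
  classical
  rw [cycleProd_eq_prod x σ w (fun v => (⟨cycleThrough σ v, cycleThrough_mem σ v⟩ : permCycles σ)),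
    ← Finset.prod_coe_sort]
  · refine Finset.prod_congr rfl fun c _ => ?_
    rw [sum_map_toMultiset _ c.1.2]
    congr 2
    ext v
    simp only [Finset.mem_filter, Finset.mem_univ, true_and]
    constructor
    · intro hv; exact Subtype.ext (eq_cycleThrough c.2 hv).symm
    · rintro rfl; exact self_mem_cycleThrough σ v
  · rintro ⟨c, hc⟩
    obtain ⟨v, hv⟩ := exists_mem_of_ne_nil (mem_permCycles.1 hc).1
    exact ⟨v, Subtype.ext (eq_cycleThrough hc hv).symm⟩
  · intro u v
    rw [Subtype.mk_eq_mk]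
    exact cycleThrough_eq_iff σ u v

/-- The cycle indicator polynomial as a sum over permutations. -/
theorem aeval_cycleIndicator {R : Type*} [CommRing R] (x : ℕ → R) (Γ : Digraph V) (w : V → ℕ) :
    MvPolynomial.aeval x (cycleIndicator Γ w) = permSum x Γ.Adj w := by
  classical
  rw [cycleIndicator, cyclePathIndicator, map_sum, map_sum, permSum, ← Finset.sum_filter]
  symm
  -- Permutations inject into the covers with no path; the covers outside the image contain a path
  -- and contribute zero.
  refine Finset.sum_of_injOn (fun σ => (permCycles σ, ∅)) ?_ ?_ ?_ ?_
  · intro σ _ ρ _ h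
    exact permCycles_injective (Prod.mk.inj h).1
  · intro σ hσ
    simp only [Finset.coe_filter, Finset.mem_univ, true_and, Set.mem_ofPred_eq] at hσ ⊢
    exact isCyclePathCover_permCycles hσ
  · rintro ⟨C, P⟩ hCP hn
    simp only [Finset.mem_filter, Finset.mem_univ, true_and] at hCP
    rcases P.eq_empty_or_nonempty with rfl | ⟨l, hl⟩
    · obtain ⟨σ, h1, rfl⟩ := exists_permCycles_eq hCP
      exact absurd ⟨σ, by simpa using h1, rfl⟩ hn
    · simp only [map_mul, map_prod, MvPolynomial.aeval_X, Sum.elim_inr, Pi.zero_apply, map_zero]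
      -- The path `l` contributes a variable that has been set to zero.
      rw [Finset.prod_eq_zero hl rfl, mul_zero]
  · intro σ _
    simp only [map_prod, MvPolynomial.aeval_X, Sum.elim_inl, Finset.prod_empty, mul_one]
    exact (prod_permCycles x σ w).symm

end CycleCovers

/-! ### The noncrossing pairing of a Dyck path by first returns -/

section NoncrossingPairing

variable {n : ℕ} {ε : Fin (2 * n) → Bool}

/-- The step of the lattice path at a position. -/
def step (ε : Fin (2 * n) → Bool) (p : Fin (2 * n)) : ℤ := if ε p = true then 1 else -1

/-- The total height of the lattice path of a word after its first `m` letters. -/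
def totalHeight (ε : Fin (2 * n) → Bool) (m : ℕ) : ℤ :=
  ∑ p with p.val < m, step ε p

theorem totalHeight_zero : totalHeight ε 0 = 0 := by simp [totalHeight]

theorem totalHeight_sub {l m : ℕ} (h : l ≤ m) :
    totalHeight ε m = totalHeight ε l + ∑ p with l ≤ p.val ∧ p.val < m, step ε p := by
  rw [totalHeight, totalHeight, ← Finset.sum_union]
  · congr 1
    ext p
    simp only [Finset.mem_filter, Finset.mem_univ, true_and, Finset.mem_union]
    omega
  · rw [Finset.disjoint_filter]
    intro p _ h1 h2
    omega

theorem totalHeight_succ (p : Fin (2 * n)) :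
    totalHeight ε (p + 1) = totalHeight ε p + step ε p := by
  rw [totalHeight_sub (Nat.le_succ p.val), Finset.sum_eq_single p]
  · intro q hq hqp
    simp only [Finset.mem_filter, Finset.mem_univ, true_and] at hq
    exact absurd (Fin.ext (by omega)) hqp
  · intro h
    exact absurd (by simp) h

theorem totalHeight_eq_sum_height {ι : Type*} (i : Fin (2 * n) → ι) [DecidableEq ι] (m : ℕ) :
    totalHeight ε m = ∑ a ∈ Finset.univ.image i, height ε i a m := by
  classical
  simp only [totalHeight, height, step]
  rw [← Finset.sum_fiberwise_of_maps_to (t := Finset.univ.image i) (g := i)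
    (fun p _ => Finset.mem_image_of_mem i (Finset.mem_univ p))]
  refine Finset.sum_congr rfl fun a _ => ?_
  rw [Finset.filter_filter]
  refine Finset.sum_congr ?_ fun _ _ => rfl
  ext p
  simp

/-- A Dyck path: nonnegative, and returning to zero. -/
def IsDyckPath (ε : Fin (2 * n) → Bool) : Prop :=
  (∀ m ≤ 2 * n, 0 ≤ totalHeight ε m) ∧ totalHeight ε (2 * n) = 0

/-- The total height is the sum of the heights of the colours that occur. -/
theorem IsDyckWord.isDyckPath {ι : Type*} {i : Fin (2 * n) → ι} (h : IsDyckWord ε i) :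
    IsDyckPath ε := by
  classical
  refine ⟨fun m hm => ?_, ?_⟩
  · rw [totalHeight_eq_sum_height i]
    exact Finset.sum_nonneg fun a _ => (h a).1 m hm
  · rw [totalHeight_eq_sum_height i]
    exact Finset.sum_eq_zero fun a _ => (h a).2

/-- `b` is the position at which the lattice path returns for the first time to its height before
the up step at `p`. -/
structure IsFirstReturn (ε : Fin (2 * n) → Bool) (p b : Fin (2 * n)) : Prop where
  lt : p < b
  height_eq : totalHeight ε (b + 1) = totalHeight ε p
  height_lt : ∀ m : ℕ, p.val < m → m ≤ b → totalHeight ε p < totalHeight ε m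

theorem step_eq_or (ε : Fin (2 * n) → Bool) (p : Fin (2 * n)) :
    (ε p = true ∧ step ε p = 1) ∨ (ε p = false ∧ step ε p = -1) := by
  unfold step
  cases ε p <;> simp

namespace IsFirstReturn

variable {p b q c : Fin (2 * n)}

theorem left (h : IsFirstReturn ε p b) : ε p = true := by
  have h1 := h.height_lt (p + 1) (by omega) h.lt
  have h2 := totalHeight_succ (ε := ε) p
  rcases step_eq_or ε p with h3 | h3
  · exact h3.1
  · omega

theorem right (h : IsFirstReturn ε p b) : ε b = false := by
  have h1 := h.height_lt b h.lt le_rfl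
  have h2 := totalHeight_succ (ε := ε) b
  have h4 := h.height_eq
  rcases step_eq_or ε b with h3 | h3
  · omega
  · exact h3.1

theorem right_unique (h : IsFirstReturn ε p b) (h' : IsFirstReturn ε p c) : b = c := by
  wlog hbc : b < c generalizing b c
  · rcases eq_or_lt_of_le (not_lt.1 hbc) with h1 | h1
    · exact h1.symm
    · exact (this h' h h1).symm
  · have h1 := h'.height_lt (b + 1) (by have := h.lt; omega) hbc
    rw [h.height_eq] at h1
    exact absurd h1 (lt_irrefl _)

theorem left_unique (h : IsFirstReturn ε p b) (h' : IsFirstReturn ε q b) : p = q := by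
  wlog hpq : p < q generalizing p q
  · rcases eq_or_lt_of_le (not_lt.1 hpq) with h1 | h1
    · exact h1.symm
    · exact (this h' h h1).symm
  · have h1 := h.height_lt q hpq h'.lt.le
    rw [← h'.height_eq, h.height_eq] at h1
    exact absurd h1 (lt_irrefl _)

/-- A crossing would give contradictory heights: at time `q` the path is above its level at `p`, and
at time `b + 1`, which is still inside the arc of `q`, it is above its level at `q`; but at `b + 1`
it is back at the level of `p`. -/
theorem noncrossing (h : IsFirstReturn ε p b) (h' : IsFirstReturn ε q c) :
    ¬(p < q ∧ q < b ∧ b < c) := by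
  rintro ⟨h1, h2, h3⟩
  have e1 := h.height_lt q h1 h2.le
  have e2 := h'.height_lt (b + 1) (by omega) h3
  rw [h.height_eq] at e2
  exact lt_asymm e1 e2

end IsFirstReturn

/-- The first time after `p` at which the path is no longer above its level at `p` exists because
the path ends at zero; since the steps are `±1`, the level is hit exactly. -/
theorem IsDyckPath.exists_right (h : IsDyckPath ε) {p : Fin (2 * n)} (hp : ε p = true) :
    ∃ b, IsFirstReturn ε p b := by
  classical
  have hex : ∃ m, p.val < m ∧ totalHeight ε m ≤ totalHeight ε p :=
    ⟨2 * n, p.2, by rw [h.2]; exact h.1 p p.2.le⟩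
  have hm := Nat.find_spec hex
  have hmin := fun {m} => Nat.find_min hex (m := m)
  have hle : Nat.find hex ≤ 2 * n :=
    Nat.find_min' hex ⟨p.2, by rw [h.2]; exact h.1 p p.2.le⟩
  set m := Nat.find hex
  have hs := totalHeight_succ (ε := ε) p
  rw [step, if_pos hp] at hs
  have hne : m ≠ p + 1 := by
    intro he
    rw [he] at hm
    omega
  have hlt : ∀ k : ℕ, p.val < k → k < m → totalHeight ε p < totalHeight ε k := by
    intro k h1 h2
    by_contra h3
    exact hmin h2 ⟨h1, not_lt.1 h3⟩
  -- Heights are taken before a letter is read, so a return at time `m` is made by the letter at `m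
  -- - 1`.
  refine ⟨⟨m - 1, by omega⟩, ?_, ?_, ?_⟩
  · rw [Fin.lt_def]; dsimp only; omega
  · have h1 := hlt (m - 1) (by omega) (by omega)
    have h2 := totalHeight_succ (ε := ε) ⟨m - 1, by omega⟩
    dsimp only at h2 ⊢
    have e : m - 1 + 1 = m := by omega
    rw [e] at h2 ⊢
    rcases step_eq_or ε ⟨m - 1, by omega⟩ with h3 | h3 <;> omega
  · intro k h1 h2
    dsimp only at h2
    exact hlt k h1 (by omega)

/-- The left point is the last time up to `b` at which the path is not above its height after `b`.
Such a time exists since the path starts at zero, and the unit steps again force equality. -/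
theorem IsDyckPath.exists_left (h : IsDyckPath ε) {b : Fin (2 * n)} (hb : ε b = false) :
    ∃ p, IsFirstReturn ε p b := by
  classical
  let P : ℕ → Prop := fun m => totalHeight ε m ≤ totalHeight ε (b + 1)
  have h0 : P 0 := by
    change totalHeight ε 0 ≤ _
    rw [totalHeight_zero]; exact h.1 _ b.2
  have hm : P (Nat.findGreatest P b) := Nat.findGreatest_spec (Nat.zero_le _) h0
  have hgt : ∀ k, Nat.findGreatest P b < k → k ≤ b → totalHeight ε (b + 1) < totalHeight ε k :=
    fun k h1 h2 => not_le.1 (Nat.findGreatest_is_greatest h1 h2)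
  have hle : Nat.findGreatest P b ≤ b := Nat.findGreatest_le _
  set m := Nat.findGreatest P b
  have hs := totalHeight_succ (ε := ε) b
  rw [step, if_neg (by simp [hb])] at hs
  have hne : m ≠ b := by
    intro he
    have : totalHeight ε m ≤ totalHeight ε (b + 1) := hm
    rw [he] at this
    omega
  have hm' : totalHeight ε m = totalHeight ε (b + 1) := by
    have h1 := hgt (m + 1) (by omega) (by omega)
    have h2 := totalHeight_succ (ε := ε) ⟨m, by omega⟩
    have h3 : totalHeight ε m ≤ totalHeight ε (b + 1) := hm
    dsimp only at h2
    rcases step_eq_or ε ⟨m, by omega⟩ with h4 | h4 <;> omega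
  refine ⟨⟨m, by omega⟩, ?_, hm'.symm, ?_⟩
  · rw [Fin.lt_def]; dsimp only; omega
  · intro k h1 h2
    dsimp only at h1 ⊢
    rw [hm']
    exact hgt k h1 h2

/-- The interior of an arc is mapped to itself: a partner outside would produce a crossing on one of
the two sides. -/
theorem IsNoncrossingPairing.mem_interval {π : Equiv.Perm (Fin (2 * n))}
    (h : IsNoncrossingPairing ε π) {p q : Fin (2 * n)} (h1 : p < q) (h2 : q < π p) :
    p < π q ∧ π q < π p := by
  have hi := h.involutive
  have e1 : π q ≠ p := by rintro rfl; rw [hi] at h2; exact lt_irrefl _ h2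
  have e2 : π q ≠ π p := fun h' => h1.ne' (π.injective h')
  refine ⟨lt_of_not_ge fun h3 => ?_, lt_of_not_ge fun h3 => ?_⟩
  · exact h.noncrossing (π q) p ⟨lt_of_le_of_ne h3 e1, by rw [hi]; exact h1, by rw [hi]; exact h2⟩
  · exact h.noncrossing p q ⟨h1, h2, lt_of_le_of_ne h3 e2.symm⟩

theorem IsNoncrossingPairing.step_apply {π : Equiv.Perm (Fin (2 * n))}
    (h : IsNoncrossingPairing ε π) (p : Fin (2 * n)) : step ε (π p) = -step ε p := by
  have h1 := h.left_iff p
  have h2 := h.left_iff (π p)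
  rw [h.involutive] at h2
  have h3 := h.ne_self p
  unfold step
  rcases lt_or_gt_of_ne h3 with h4 | h4
  · rw [if_pos (h2.2 h4), if_neg (fun h5 => lt_asymm h4 (h1.1 h5)), neg_neg]
  · rw [if_pos (h1.2 h4), if_neg (fun h5 => lt_asymm h4 (h2.1 h5))]

/-- This yields uniqueness, since first returns depend on the path alone. The steps over a whole arc
cancel in pairs. Over an initial part of its interior they have nonnegative sum, because each down
step is paired with an earlier up step in that part. -/
theorem IsNoncrossingPairing.isFirstReturn {π : Equiv.Perm (Fin (2 * n))}
    (h : IsNoncrossingPairing ε π) {p : Fin (2 * n)} (hp : ε p = true) :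
    IsFirstReturn ε p (π p) := by
  classical
  have hi := h.involutive
  have hlt := (h.left_iff p).1 hp
  refine ⟨hlt, ?_, ?_⟩
  · rw [totalHeight_sub (show p.val ≤ π p + 1 by rw [Fin.lt_def] at hlt; omega), add_eq_left]
    refine Finset.sum_involution (fun q _ => π q) ?_ ?_ ?_ ?_
    · intro q _; rw [h.step_apply, add_neg_cancel]
    · intro q _ _; exact h.ne_self q
    · intro q hq
      simp only [Finset.mem_filter, Finset.mem_univ, true_and, Nat.lt_succ_iff,
        ← Fin.le_def] at hq ⊢
      rcases hq.1.eq_or_lt with rfl | h1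
      · exact ⟨hlt.le, le_rfl⟩
      rcases hq.2.eq_or_lt with rfl | h2
      · rw [hi]; exact ⟨le_rfl, hlt.le⟩
      · exact ⟨(h.mem_interval h1 h2).1.le, (h.mem_interval h1 h2).2.le⟩
    · intro q _; exact hi q
  · intro m h1 h2
    have h3 := totalHeight_succ (ε := ε) p
    rw [step, if_pos hp] at h3
    rw [totalHeight_sub (show p.val + 1 ≤ m from h1), h3]
    suffices 0 ≤ ∑ q : Fin (2 * n) with p.val + 1 ≤ q.val ∧ q.val < m, step ε q by omega
    simp only [step]
    rw [Finset.sum_ite, Finset.sum_const, Finset.sum_const]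
    simp only [nsmul_eq_mul, mul_one, mul_neg, ← sub_eq_add_neg, sub_nonneg, Nat.cast_le]
    -- The pairing injects the creators in this range into its annihilators.
    refine Finset.card_le_card_of_injOn π ?_ π.injective.injOn
    intro q hq
    simp only [Finset.coe_filter, Finset.mem_filter, Finset.mem_univ, true_and,
      Set.mem_ofPred_eq] at hq ⊢
    obtain ⟨⟨h4, h5⟩, h6⟩ := hq
    have h7 := h.mem_interval (p := p) (q := q) h4 (by rw [Fin.lt_def]; omega)
    have h8 : π q < q := lt_of_le_of_ne (not_lt.1 fun h' => h6 ((h.left_iff q).2 h')) (h.ne_self q)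
    refine ⟨⟨h7.1, lt_trans h8 h5⟩, (h.left_iff _).2 ?_⟩
    rw [hi]; exact h8

theorem IsNoncrossingPairing.eq {π π' : Equiv.Perm (Fin (2 * n))}
    (h : IsNoncrossingPairing ε π) (h' : IsNoncrossingPairing ε π') : π = π' := by
  ext1 p
  rcases lt_or_gt_of_ne (h.ne_self p) with hp | hp
  · have h1 : ε (π p) = true := (h.left_iff _).2 (by rw [h.involutive]; exact hp)
    have h2 := (h.isFirstReturn h1).right_unique (h'.isFirstReturn h1)
    rw [h.involutive] at h2
    exact π'.injective (by rw [h'.involutive, ← h2])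
  · have h1 := (h.left_iff _).2 hp
    exact (h.isFirstReturn h1).right_unique (h'.isFirstReturn h1)

theorem IsDyckPath.exists_pairing (h : IsDyckPath ε) : ∃ π, IsNoncrossingPairing ε π := by
  classical
  have hex : ∀ p, ∃ b, IsFirstReturn ε p b ∨ IsFirstReturn ε b p := by
    intro p
    rcases step_eq_or ε p with hp | hp
    · exact (h.exists_right hp.1).imp fun _ => Or.inl
    · exact (h.exists_left hp.1).imp fun _ => Or.inr
  choose f hf using hex
  have hf' : ∀ p b, IsFirstReturn ε p b ∨ IsFirstReturn ε b p → f p = b := by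
    rintro p b (hb | hb) <;> rcases hf p with h1 | h1
    · exact h1.right_unique hb
    · exact absurd (h1.right.symm.trans hb.left) (by simp)
    · exact absurd (hb.right.symm.trans h1.left) (by simp)
    · exact h1.left_unique hb
  have hinv : Function.Involutive f := fun p => hf' _ _ (hf p).symm
  refine ⟨hinv.toPerm, hinv, fun p => ?_, fun p => ?_, fun p q => ?_⟩
  · change f p ≠ p
    rcases hf p with h1 | h1
    · exact h1.lt.ne'
    · exact h1.lt.ne
  · change _ ↔ p < f p
    rcases hf p with h1 | h1
    · exact iff_of_true h1.left h1.lt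
    · exact iff_of_false (by simp [h1.right]) h1.lt.not_gt
  · change ¬(p < q ∧ q < f p ∧ f p < f q)
    rintro ⟨h1, h2, h3⟩
    rcases hf p with h4 | h4
    · rcases hf q with h5 | h5
      · exact h4.noncrossing h5 ⟨h1, h2, h3⟩
      · exact absurd (h5.lt.trans (h2.trans h3)) (lt_irrefl _)
    · exact absurd (h4.lt.trans (h1.trans h2)) (lt_irrefl _)

theorem IsDyckPath.existsUnique_pairing (h : IsDyckPath ε) :
    ∃! π, IsNoncrossingPairing ε π := by
  obtain ⟨π, hπ⟩ := h.exists_pairing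
  exact ⟨π, hπ, fun _ h' => h'.eq hπ⟩

end NoncrossingPairing

/-! ### Masses and moments of the alphabet -/

section LetterIntegrals

variable (t : ThomaParam)

/-- The sign attached to negative letters is what turns the mass `β i` into the weight `-β i`; a
continuous letter has mass and weight zero. This is the source of the extra factor `a` when two
letters are contracted. -/
theorem measureReal_singleton (z : Letter) (s : ℝ) (hs : (IsNeg z → s = -1) ∧ (¬IsNeg z → s = 1)) :
    (letterMeasure t).real {z} * s = letterWeight t z := by
  have hm : Measurable (fun s : ℝ => (Sum.inr (Sum.inr s) : Letter)) :=
    measurable_inr.comp measurable_inr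
  rw [Measure.real]
  simp only [letterMeasure, Measure.coe_add, Pi.add_apply,
    Measure.sum_apply _ (measurableSet_singleton z), Measure.smul_apply, smul_eq_mul,
    Measure.map_apply hm (measurableSet_singleton z), Measure.dirac_apply' _
    (measurableSet_singleton z), Set.indicator_apply, Set.mem_singleton_iff, Pi.one_apply]
  rcases z with i | i | r
  · have h0 : (fun s : ℝ => (Sum.inr (Sum.inr s) : Letter)) ⁻¹' {Sum.inl i} = ∅ := by
      ext s; simp
    have h1 : s = 1 := hs.2 (by rintro ⟨k, hk⟩; simp at hk)
    rw [h0, tsum_eq_single i (by intro k hk; simp [hk])]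
    simp [letterWeight, h1, t.α_nonneg i]
  · have h0 : (fun s : ℝ => (Sum.inr (Sum.inr s) : Letter)) ⁻¹' {Sum.inr (Sum.inl i)} = ∅ := by
      ext s; simp
    have h1 : s = -1 := hs.1 ⟨i, rfl⟩
    have h2 : (∑' k, ENNReal.ofReal (t.β k) *
        if (Sum.inr (Sum.inl k) : Letter) = Sum.inr (Sum.inl i) then 1 else 0) =
        ENNReal.ofReal (t.β i) := by
      rw [tsum_eq_single i (by intro k hk; simp [hk])]; simp
    rw [h0, h2]
    simp [letterWeight, h1, t.β_nonneg i]
  · have h0 : (fun s : ℝ => (Sum.inr (Sum.inr s) : Letter)) ⁻¹' {Sum.inr (Sum.inr r)} = {r} := by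
      ext s; simp
    rw [h0]
    simp [letterWeight]

theorem integrable_letterWeight_pow (k : ℕ) {μ : Measure Letter} [IsFiniteMeasure μ] :
    Integrable (fun z => letterWeight t z ^ k) μ := by
  refine Integrable.of_bound ((measurable_letterWeight t).pow_const k).aestronglyMeasurable 1
    (Filter.Eventually.of_forall fun z => ?_)
  rw [Real.norm_eq_abs, abs_pow]
  exact pow_le_one₀ (abs_nonneg _) (abs_letterWeight_le t z)

theorem integral_letterWeight_pow (k : ℕ) :
    ∫ z, letterWeight t z ^ k ∂letterMeasure t = thomaVariable t (k + 1) := by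
  have hm : Measurable (fun s : ℝ => (Sum.inr (Sum.inr s) : Letter)) :=
    measurable_inr.comp measurable_inr
  have hγ : 0 ≤ t.γ := by have := t.sum_le_one; unfold ThomaParam.γ; linarith
  have hint := integrable_letterWeight_pow t k (μ := letterMeasure t)
  rw [letterMeasure] at hint ⊢
  have h3 := hint.right_of_add_measure
  have h12 := hint.left_of_add_measure
  have h1 := h12.left_of_add_measure
  have h2 := h12.right_of_add_measure
  rw [integral_add_measure h12 h3, integral_add_measure h1 h2, integral_sum_measure h1,
    integral_sum_measure h2, integral_map hm.aemeasurable
      ((measurable_letterWeight t).pow_const k).aestronglyMeasurable]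
  simp only [integral_smul_measure, integral_dirac, ENNReal.toReal_ofReal (t.α_nonneg _),
    ENNReal.toReal_ofReal (t.β_nonneg _), letterWeight, Sum.elim_inl, Sum.elim_inr, smul_eq_mul,
    setIntegral_const, Measure.real, Real.volume_Icc, sub_zero, ENNReal.toReal_ofReal hγ]
  -- For exponent zero the continuous part contributes its mass `γ`, because `0 ^ 0 = 1`, and the
  -- total is one. For positive exponents it contributes nothing, and the mass of each atom supplies
  -- the missing power.
  rcases k with _ | k
  · simp [thomaVariable, ThomaParam.γ]
  · simp only [thomaVariable]
    rw [if_neg (by omega), zero_pow (by omega), mul_zero, add_zero, ← tsum_mul_left]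
    congr 1
    · exact tsum_congr fun i => (pow_succ' _ _).symm
    · refine tsum_congr fun i => ?_
      rw [neg_pow]
      ring

end LetterIntegrals

/-! ### Signs of extended permutations and of transpositions -/

section Signs

theorem koszulSign_extendPerm {n : ℕ} (σ : Equiv.Perm (Fin n)) (x : Word (n + 1)) :
    koszulSign (extendPerm σ) x = koszulSign σ (Fin.init x) := by
  have h1 : ∀ i : Fin n, (extendPerm σ)⁻¹ i.castSucc = (σ⁻¹ i).castSucc := fun i => by
    change (extendPerm σ).symm _ = _
    simp [extendPerm]
  have h2 : (extendPerm σ)⁻¹ (Fin.last n) = Fin.last n := by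
    change (extendPerm σ).symm _ = _
    simp [extendPerm]
  simp only [koszulSign, Fin.prod_univ_castSucc, h1, h2, Fin.castSucc_lt_castSucc_iff, Fin.init,
    (Fin.castSucc_lt_last _).not_gt, lt_irrefl, false_and, and_false, if_false,
    Finset.prod_const_one, mul_one]
  refine Finset.prod_congr rfl fun p _ => Finset.prod_congr rfl fun q _ => ?_
  congr 1
  rw [h1, h1, Fin.castSucc_lt_castSucc_iff, Fin.castSucc_lt_castSucc_iff]

open Classical in
-- The transposition inverts the pair of its two points and, for every position `r` strictly between
-- them, the two pairs formed by `r` and one of its points. As the two exchanged letters agree, the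
-- latter two signs are equal and cancel.
theorem koszulSign_swap_last {n : ℕ} (i : Fin n) (x : Word (n + 1))
    (hx : x i.castSucc = x (Fin.last n)) :
    koszulSign (Equiv.swap i.castSucc (Fin.last n)) x =
      if IsNeg (x (Fin.last n)) then -1 else 1 := by
  set l := Fin.last n
  set a := i.castSucc with ha
  have hal : a < l := Fin.castSucc_lt_last i
  let N : ℂ := if IsNeg (x l) then -1 else 1
  -- `g r` is the common sign of the pairs `(a, r)` and `(r, l)`, and `N` is that of `(a, l)`.
  let g : Fin (n + 1) → ℂ := fun r => if a < r ∧ r < l ∧ IsNeg (x l) ∧ IsNeg (x r) then -1 else 1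
  have hle : ∀ p : Fin (n + 1), p ≤ l := Fin.le_last
  have key : ∀ p q, (if p < q ∧ (Equiv.swap a l)⁻¹ q < (Equiv.swap a l)⁻¹ p ∧ IsNeg (x p) ∧
      IsNeg (x q) then (-1 : ℂ) else 1) =
      (if p = a then (if q = l then N else 1) * g q else 1) * (if q = l then g p else 1) := by
    intro p q
    rw [Equiv.swap_inv]
    by_cases hq : q = l
    · subst hq
      rw [Equiv.swap_apply_right]
      by_cases hp : p = a
      · subst hp
        rw [Equiv.swap_apply_left]
        simp [g, N, hal, hx]
      · by_cases hp' : p = l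
        · simp [hp', g, hal.ne']
        · rw [Equiv.swap_apply_of_ne_of_ne hp hp']
          simp only [hp, if_false, if_true, one_mul, g]
          refine if_congr ?_ rfl rfl
          tauto
    · by_cases hp : p = a
      · subst hp
        rw [Equiv.swap_apply_left]
        by_cases hq' : q = a
        · simp [hq', g, hal.ne]
        · rw [Equiv.swap_apply_of_ne_of_ne hq' hq]
          simp only [hq, if_false, if_true, one_mul, mul_one, g, hx]
      · simp only [hp, hq, if_false, mul_one]
        refine if_neg ?_
        rintro ⟨h1, h2, -⟩
        have hpl : p ≠ l := fun h => absurd (hle q) (not_le.2 (h ▸ h1))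
        rw [Equiv.swap_apply_of_ne_of_ne hp hpl] at h2
        by_cases hq' : q = a
        · rw [hq', Equiv.swap_apply_left] at h2
          exact absurd (hle p) (not_le.2 h2)
        · rw [Equiv.swap_apply_of_ne_of_ne hq' hq] at h2
          exact lt_asymm h1 h2
  have hgl : ∀ r, g r * g r = 1 := fun r => by simp only [g]; split_ifs <;> norm_num
  rw [koszulSign]
  simp only [key, Finset.prod_mul_distrib, Finset.prod_ite_eq', Finset.mem_univ, if_true]
  have e : ∀ p : Fin (n + 1), (∏ q, if p = a then (if q = l then N else 1) * g q else 1) =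
      if p = a then N * ∏ q, g q else 1 := by
    intro p
    by_cases hp : p = a
    · simp only [hp, if_true, Finset.prod_mul_distrib, Finset.prod_ite_eq', Finset.mem_univ]
    · simp [hp]
  simp only [e, Finset.prod_ite_eq', Finset.mem_univ, if_true]
  rw [mul_assoc, ← Finset.prod_mul_distrib]
  simp [hgl, N]

end Signs

/-! ### Unitarity of the symmetric group actions -/

section Unitarity

variable (t : ThomaParam) {n : ℕ}

theorem norm_weightedComp_le {A B : Type*} [MeasurableSpace A] [MeasurableSpace B] {μ : Measure A}
    {ν : Measure B} {S : Set A} {T : A → B} {g : A → ℂ} (hS : MeasurableSet S)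
    (hT : MeasurePreserving T (μ.restrict S) ν) (hg : Measurable g) (hb : ∀ a, ‖g a‖ ≤ 1) :
    ‖weightedComp S T g hS hT hg hb‖ ≤ 1 := by
  unfold weightedComp
  apply LinearMap.mkContinuous_norm_le
  exact zero_le_one

theorem norm_tensorMap_le {A B E F : Type*} [NormedAddCommGroup E] [InnerProductSpace ℂ E]
    [NormedAddCommGroup F] [InnerProductSpace ℂ F] (r : A → B) (hr : Function.Injective r)
    (T : E →L[ℂ] F) : ‖tensorMap r hr T‖ ≤ ‖T‖ := by
  unfold tensorMap
  apply LinearMap.mkContinuous_norm_le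
  exact norm_nonneg _

theorem norm_U_le (σ : Equiv.Perm (Fin n)) (h : V t n) : ‖U t σ h‖ ≤ ‖h‖ := by
  refine ((U t σ).le_of_opNorm_le (c := 1) ?_ h).trans (one_mul _).le
  exact norm_weightedComp_le _ _ _ _

/-- A contraction whose inverse is a contraction is isometric, so its adjoint is its inverse. -/
theorem inner_map_of_inverse {E : Type*} [NormedAddCommGroup E] [InnerProductSpace ℂ E]
    (A B : E →L[ℂ] E) (hA : ∀ x, ‖A x‖ ≤ ‖x‖) (hB : ∀ x, ‖B x‖ ≤ ‖x‖) (hAB : ∀ x, A (B x) = x)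
    (hBA : ∀ x, B (A x) = x) (x y : E) : ⟪A x, y⟫_ℂ = ⟪x, B y⟫_ℂ := by
  have hn : ∀ x, ‖A x‖ = ‖x‖ := fun x => le_antisymm (hA x) (by
    conv_lhs => rw [← hBA x]
    exact hB _)
  let I : E →ₗᵢ[ℂ] E := ⟨A.toLinearMap, hn⟩
  conv_lhs => rw [← hAB y]
  exact I.inner_map_map x (B y)

theorem inner_U_left (σ : Equiv.Perm (Fin n)) (f g : V t n) :
    ⟪U t σ f, g⟫_ℂ = ⟪f, U t σ⁻¹ g⟫_ℂ :=
  inner_map_of_inverse _ _ (norm_U_le t σ) (norm_U_le t σ⁻¹)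
    (fun x => by rw [← U_mul, mul_inv_cancel, U_one])
    (fun x => by rw [← U_mul, inv_mul_cancel, U_one]) f g

theorem permOp_one {ι : Type*} (f : VTensor t ι n) : permOp t ι 1 f = f := by
  ext1
  funext c
  rw [permOp_apply, U_one]
  rfl

theorem norm_permOp_le {ι : Type*} (σ : Equiv.Perm (Fin n)) (f : VTensor t ι n) :
    ‖permOp t ι σ f‖ ≤ ‖f‖ := by
  refine ((permOp t ι σ).le_of_opNorm_le (c := 1) ?_ f).trans (one_mul _).le
  exact (norm_tensorMap_le _ _ _).trans (norm_weightedComp_le _ _ _ _)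

theorem inner_permOp_left {ι : Type*} (σ : Equiv.Perm (Fin n)) (f g : VTensor t ι n) :
    ⟪permOp t ι σ f, g⟫_ℂ = ⟪f, permOp t ι σ⁻¹ g⟫_ℂ :=
  inner_map_of_inverse _ _ (norm_permOp_le t σ) (norm_permOp_le t σ⁻¹)
    (fun x => by rw [← permOp_mul, mul_inv_cancel, permOp_one])
    (fun x => by rw [← permOp_mul, inv_mul_cancel, permOp_one]) f g

end Unitarity

/-! ### Vectors supported on the diagonal -/

section Diagonal

variable (t : ThomaParam) {n : ℕ}

theorem measurableSet_diagonal_word (n : ℕ) : MeasurableSet (Set.diagonal (Word n)) := by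
  have : Set.diagonal (Word n) = ⋂ i, {p : Word n × Word n | p.1 i = p.2 i} := by
    ext p; simp [funext_iff]
  rw [this]
  exact MeasurableSet.iInter fun i => measurableSet_eq_fun
    ((measurable_pi_apply i).comp measurable_fst) ((measurable_pi_apply i).comp measurable_snd)

/-- Each word occurs exactly once among its own rearrangements, so the diagonal carries a copy of
the word measure. Hence the values `h (x, x)` of a class `h` in `V_n` are well defined almost
everywhere. -/
theorem measurePreserving_diag (n : ℕ) :
    MeasurePreserving (fun x : Word n => (x, x)) (wordMeasure t n)
      ((pairMeasure t n).restrict (Set.diagonal (Word n))) := by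
  classical
  have hm : Measurable fun x : Word n => (x, x) := measurable_id.prodMk measurable_id
  have hd : MeasurableSet (Set.diagonal (Word n)) := measurableSet_diagonal_word n
  refine ⟨hm, ?_⟩
  ext A hA
  rw [Measure.map_apply hm hA, Measure.restrict_apply hA, pairMeasure_apply t (hA.inter hd),
    ← lintegral_indicator_one (hm hA)]
  refine lintegral_congr fun x => ?_
  rw [Finset.sum_eq_single x]
  · simp [Set.indicator_apply]
  · intro y _ hy
    refine Set.indicator_of_notMem ?_ _
    rintro ⟨-, h⟩
    exact hy h.symm
  · intro h
    exact absurd (mem_rearr.2 ⟨1, by simp⟩) h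

theorem ae_diag {P : Word n × Word n → Prop} (h : ∀ᵐ p ∂pairMeasure t n, P p) :
    ∀ᵐ x ∂wordMeasure t n, P (x, x) :=
  (measurePreserving_diag t n).quasiMeasurePreserving.ae (ae_restrict_of_ae h)

theorem integrable_diag (h : V t n) : Integrable (fun x => h (x, x)) (wordMeasure t n) :=
  (((Lp.memLp h).restrict _).comp_measurePreserving (measurePreserving_diag t n)).integrable
    (by norm_num)

/-- The product of the powers `a(x_i) ^ K_i`. -/
noncomputable def weightMonomial (K : Fin n → ℕ) (x : Word n) : ℂ :=
  ∏ i, ((letterWeight t (x i) ^ K i : ℝ) : ℂ)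

theorem measurable_weightMonomial (K : Fin n → ℕ) : Measurable (weightMonomial t K) :=
  Finset.measurable_prod _ fun i _ => Complex.measurable_ofReal.comp
    (((measurable_letterWeight t).comp (measurable_pi_apply i)).pow_const _)

theorem norm_weightMonomial_le (K : Fin n → ℕ) (x : Word n) : ‖weightMonomial t K x‖ ≤ 1 := by
  rw [weightMonomial, norm_prod]
  refine Finset.prod_le_one (fun i _ => norm_nonneg _) fun i _ => ?_
  rw [Complex.norm_real, Real.norm_eq_abs, abs_pow]
  exact pow_le_one₀ (abs_nonneg _) (abs_letterWeight_le t _)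

theorem memLp_diagonal (K : Fin n → ℕ) :
    MemLp ((Set.diagonal (Word n)).indicator fun p => weightMonomial t K p.1) 2
      (pairMeasure t n) := by
  refine MemLp.of_bound (C := 1) (((measurable_weightMonomial t K).comp measurable_fst).indicator
    (measurableSet_diagonal_word n)).aestronglyMeasurable (Filter.Eventually.of_forall fun p => ?_)
  exact (norm_indicator_le_norm_self _ _).trans (norm_weightMonomial_le t K p.1)

/-- The vector `δ(x, y) ∏ a(x_i) ^ K_i` of `V_n`. -/
noncomputable def diagVec (K : Fin n → ℕ) : V t n := (memLp_diagonal t K).toLp _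

theorem coeFn_diagVec (K : Fin n → ℕ) : diagVec t K =ᵐ[pairMeasure t n]
    (Set.diagonal (Word n)).indicator fun p => weightMonomial t K p.1 :=
  MemLp.coeFn_toLp _

theorem inner_diagVec (h : V t n) (K : Fin n → ℕ) :
    ⟪h, diagVec t K⟫_ℂ =
      ∫ x, weightMonomial t K x * (starRingEnd ℂ) (h (x, x)) ∂wordMeasure t n := by
  have h1 : ⟪h, diagVec t K⟫_ℂ = ∫ p, (Set.diagonal (Word n)).indicator
      (fun p => weightMonomial t K p.1 * (starRingEnd ℂ) (h p)) p ∂pairMeasure t n := by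
    rw [L2.inner_def]
    refine integral_congr_ae ?_
    filter_upwards [coeFn_diagVec t K] with p hp
    rw [hp, RCLike.inner_apply]
    by_cases hd : p ∈ Set.diagonal (Word n)
    · simp only [Set.indicator_of_mem hd]
    · simp only [Set.indicator_of_notMem hd, zero_mul]
  rw [h1, integral_indicator (measurableSet_diagonal_word n), ← (measurePreserving_diag t n).map_eq,
    integral_map (measurePreserving_diag t n).measurable.aemeasurable]
  rw [(measurePreserving_diag t n).map_eq]
  refine (((measurable_weightMonomial t K).comp measurable_fst).aestronglyMeasurable).mul ?_
  exact (Complex.continuous_conj.comp_aestronglyMeasurable (Lp.aestronglyMeasurable h)).restrict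

theorem j_diagVec (k : ℕ) (K : Fin n → ℕ) :
    j t k n (diagVec t K) = diagVec t (Fin.snoc K k : Fin (n + 1) → ℕ) := by
  refine Lp.ext ?_
  have h := ae_restrict_iff' (measurableSet_sameLast n) |>.1
    ((measurePreserving_dropLast t n).quasiMeasurePreserving.ae (coeFn_diagVec t K))
  filter_upwards [coeFn_j t k n (diagVec t K), coeFn_diagVec t (Fin.snoc K k : Fin (n + 1) → ℕ), h]
    with p h1 h2 h3
  rw [h1, h2]
  have hd : p ∈ Set.diagonal (Word (n + 1)) ↔
      p ∈ sameLast n ∧ dropLast n p ∈ Set.diagonal (Word n) := by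
    simp only [Set.mem_diagonal_iff, sameLast, Set.mem_ofPred_eq, dropLast]
    constructor
    · intro h; rw [h]; exact ⟨rfl, rfl⟩
    · rintro ⟨h4, h5⟩
      rw [← Fin.snoc_init_self p.1, ← Fin.snoc_init_self p.2, h4, h5]
  by_cases hs : p ∈ sameLast n
  · rw [Set.indicator_of_mem hs, h3 hs]
    by_cases hp : dropLast n p ∈ Set.diagonal (Word n)
    · rw [Set.indicator_of_mem hp, Set.indicator_of_mem (hd.2 ⟨hs, hp⟩), weightMonomial,
        weightMonomial, Fin.prod_univ_castSucc, mul_comm]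
      simp [dropLast, Fin.init]
    · rw [Set.indicator_of_notMem hp, Set.indicator_of_notMem (fun h => hp (hd.1 h).2), mul_zero]
  · rw [Set.indicator_of_notMem hs, Set.indicator_of_notMem (fun h => hs (hd.1 h).1)]

theorem extendPerm_castSucc (σ : Equiv.Perm (Fin n)) (i : Fin n) :
    extendPerm σ i.castSucc = (σ i).castSucc := by simp [extendPerm]

theorem extendPerm_last (σ : Equiv.Perm (Fin n)) :
    extendPerm σ (Fin.last n) = Fin.last n := by simp [extendPerm]

theorem init_comp_extendPerm {α : Type*} (σ : Equiv.Perm (Fin n)) (x : Fin (n + 1) → α) :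
    (Fin.init (x ∘ extendPerm σ) : Fin n → α) = (Fin.init x : Fin n → α) ∘ σ := by
  funext i
  simp [Fin.init, extendPerm_castSucc]

/-- A permutation fixing the last position preserves the last letter and creates no inversion with
it. -/
theorem j_U (k : ℕ) (σ : Equiv.Perm (Fin n)) (h : V t n) :
    j t k n (U t σ h) = U t (extendPerm σ) (j t k n h) := by
  refine Lp.ext ?_
  have h1 := ae_restrict_iff' (measurableSet_sameLast n) |>.1
    ((measurePreserving_dropLast t n).quasiMeasurePreserving.ae (coeFn_U t σ h))
  have h2 := (measurePreserving_pair_perm t (extendPerm σ)).quasiMeasurePreserving.ae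
    (coeFn_j t k n h)
  filter_upwards [coeFn_j t k n (U t σ h), coeFn_U t (extendPerm σ) (j t k n h), h1, h2]
    with p e1 e2 e3 e4
  rw [e1, e2, e4]
  have hs : (p.1 ∘ extendPerm σ, p.2) ∈ sameLast n ↔ p ∈ sameLast n := by
    simp [sameLast, extendPerm_last]
  by_cases hp : p ∈ sameLast n
  · rw [Set.indicator_of_mem hp, Set.indicator_of_mem (hs.2 hp), e3 hp, koszulSign_extendPerm]
    simp only [dropLast, init_comp_extendPerm, Function.comp_apply, extendPerm_last]
    ring
  · rw [Set.indicator_of_notMem hp, Set.indicator_of_notMem (fun h => hp (hs.1 h)), mul_zero]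

theorem integral_word_succ {F : Word (n + 1) → ℂ} (hF : Integrable F (wordMeasure t (n + 1))) :
    ∫ x, F x ∂wordMeasure t (n + 1) =
      ∫ x, ∫ z, F (Fin.snoc x z : Word (n + 1)) ∂letterMeasure t ∂wordMeasure t n := by
  have h := (measurePreserving_piFinSuccAbove (fun _ : Fin (n + 1) => letterMeasure t)
    (Fin.last n)).symm
  have hF' := (h.integrable_comp_emb (MeasurableEquiv.measurableEmbedding _)).2 hF
  have e : ∀ (z : Letter) (x : Word n),
      (MeasurableEquiv.piFinSuccAbove (fun _ => Letter) (Fin.last n)).symm (z, x) =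
        (Fin.snoc x z : Word (n + 1)) := by
    intro z x
    simp [MeasurableEquiv.piFinSuccAbove, Fin.insertNthEquiv, Fin.insertNth_last']
  have h1 := h.integral_comp' F
  rw [wordMeasure, ← h1]
  refine (integral_prod_symm _ hF').trans ?_
  simp only [Function.comp_apply, e]
  rfl

end Diagonal

/-! ### Integrating out the last letter -/

section Contraction

variable (t : ThomaParam) {n : ℕ}

open Classical in
-- Only the atom at `z₀` is seen, and its signed mass is one more factor `a(z₀)`.
theorem integral_single_letter (z₀ : Letter) (m : ℕ) (c : ℂ) :
    ∫ z, (if z₀ = z then c * ((if IsNeg z then -1 else 1) * ((letterWeight t z ^ m : ℝ) : ℂ))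
      else 0) ∂letterMeasure t = c * ((letterWeight t z₀ ^ (m + 1) : ℝ) : ℂ) := by
  have h : (fun z => if z₀ = z then
      c * ((if IsNeg z then -1 else 1) * ((letterWeight t z ^ m : ℝ) : ℂ)) else 0) =
      Set.indicator {z₀} fun z =>
        c * ((if IsNeg z then -1 else 1) * ((letterWeight t z ^ m : ℝ) : ℂ)) := by
    funext z
    simp only [Set.indicator_apply, Set.mem_singleton_iff, eq_comm]
  rw [h, integral_indicator (measurableSet_singleton z₀), integral_singleton]
  have h2 := measureReal_singleton t z₀ (if IsNeg z₀ then -1 else 1)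
    ⟨fun h => if_pos h, fun h => if_neg h⟩
  rw [pow_succ', ← h2, Complex.real_smul]
  push_cast
  split_ifs <;> push_cast <;> ring

theorem weightMonomial_snoc (K : Fin (n + 1) → ℕ) (x : Word n) (z : Letter) :
    weightMonomial t K (Fin.snoc x z : Word (n + 1)) =
      weightMonomial t (Fin.init K : Fin n → ℕ) x *
        ((letterWeight t z ^ K (Fin.last n) : ℝ) : ℂ) := by
  simp [weightMonomial, Fin.prod_univ_castSucc, Fin.init]

theorem weightMonomial_update (K : Fin n → ℕ) (i : Fin n) (m : ℕ) (x : Word n) :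
    weightMonomial t (Function.update K i (K i + m)) x =
      weightMonomial t K x * ((letterWeight t (x i) ^ m : ℝ) : ℂ) := by
  classical
  have h : ∀ l : Fin n, ((letterWeight t (x l) ^ Function.update K i (K i + m) l : ℝ) : ℂ) =
      ((letterWeight t (x l) ^ K l : ℝ) : ℂ) *
        if l = i then ((letterWeight t (x i) ^ m : ℝ) : ℂ) else 1 := by
    intro l
    by_cases hl : l = i
    · subst hl; simp [pow_add]
    · simp [hl]
  simp only [weightMonomial, h, Finset.prod_mul_distrib, Finset.prod_ite_eq', Finset.mem_univ,
    if_true]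

theorem integrable_weightMonomial_mul (K : Fin n → ℕ) (h : V t n) :
    Integrable (fun x => weightMonomial t K x * (starRingEnd ℂ) (h (x, x))) (wordMeasure t n) := by
  refine Integrable.bdd_mul (c := 1) ?_ (measurable_weightMonomial t K).aestronglyMeasurable
    (Filter.Eventually.of_forall (norm_weightMonomial_le t K))
  exact Complex.conjLIE.toContinuousLinearEquiv.toContinuousLinearMap.integrable_comp
    (integrable_diag t h)

/-- Pairing of `j h` with a diagonal vector. -/
theorem inner_j_diagVec (k : ℕ) (h : V t n) (K : Fin (n + 1) → ℕ) :
    ⟪j t k n h, diagVec t K⟫_ℂ = (thomaVariable t (K (Fin.last n) + k + 1) : ℂ) *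
      ⟪h, diagVec t (Fin.init K : Fin n → ℕ)⟫_ℂ := by
  have hj := ae_diag t (coeFn_j t k n h)
  have hint := integrable_weightMonomial_mul t K (j t k n h)
  let F : Word (n + 1) → ℂ := fun x => weightMonomial t K x * (starRingEnd ℂ)
    (((letterWeight t (x (Fin.last n)) ^ k : ℝ) : ℂ) * h (Fin.init x, Fin.init x))
  have hF : (fun x => weightMonomial t K x * (starRingEnd ℂ) (j t k n h (x, x)))
      =ᵐ[wordMeasure t (n + 1)] F := by
    filter_upwards [hj] with x hx
    rw [hx, Set.indicator_of_mem (by rfl)]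
    rfl
  rw [inner_diagVec, integral_congr_ae hF, integral_word_succ t (hint.congr hF), inner_diagVec,
    ← integral_const_mul]
  refine integral_congr_ae (Filter.Eventually.of_forall fun x => ?_)
  simp only [F, weightMonomial_snoc, Fin.snoc_last, Fin.init_snoc, map_mul, Complex.conj_ofReal]
  rw [← integral_letterWeight_pow, ← integral_complex_ofReal, ← integral_mul_const]
  refine integral_congr_ae (Filter.Eventually.of_forall fun z => ?_)
  simp only [pow_add, Complex.ofReal_mul]
  ring

/-- Pairing of `j h` with a diagonal vector moved by a transposition of the last letter. -/
theorem inner_j_U_swap (k : ℕ) (h : V t n) (K : Fin (n + 1) → ℕ) (i : Fin n) :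
    ⟪j t k n h, U t (Equiv.swap i.castSucc (Fin.last n)) (diagVec t K)⟫_ℂ =
      ⟪h, diagVec t (Function.update (Fin.init K : Fin n → ℕ) i
        (K i.castSucc + (K (Fin.last n) + k + 1)))⟫_ℂ := by
  classical
  set s := Equiv.swap i.castSucc (Fin.last n) with hs
  have hinv : s⁻¹ = s := Equiv.swap_inv _ _
  have hU := ae_diag t (coeFn_U t s (j t k n h))
  have hj := ae_diag t ((measurePreserving_pair_perm t s).quasiMeasurePreserving.ae
    (coeFn_j t k n h))
  have hint := integrable_weightMonomial_mul t K (U t s (j t k n h))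
  -- On the diagonal, the factor `δ` in `j` compares the last letters of `x ∘ s` and `x`, that is,
  -- `x_i` with `x_{n+1}`. Where they agree, `s` fixes `x` and only the sign of the transposition
  -- remains.
  let F : Word (n + 1) → ℂ := fun x => if x i.castSucc = x (Fin.last n) then
    weightMonomial t K x * (starRingEnd ℂ) ((if IsNeg (x (Fin.last n)) then -1 else 1) *
      (((letterWeight t (x (Fin.last n)) ^ k : ℝ) : ℂ) * h (Fin.init x, Fin.init x))) else 0
  have hF : (fun x => weightMonomial t K x * (starRingEnd ℂ) (U t s (j t k n h) (x, x)))
      =ᵐ[wordMeasure t (n + 1)] F := by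
    filter_upwards [hU, hj] with x h1 h2
    rw [h1, h2]
    simp only [F]
    by_cases hx : x i.castSucc = x (Fin.last n)
    · have hxs : x ∘ s = x := by
        funext l
        simp only [hs, Function.comp_apply, Equiv.swap_apply_def]
        split_ifs with h3 h4
        · rw [h3, hx]
        · rw [h4, hx]
        · rfl
      rw [if_pos hx, hxs, Set.indicator_of_mem (by rfl), koszulSign_swap_last i x hx]
      rfl
    · rw [if_neg hx, Set.indicator_of_notMem, mul_zero, map_zero, mul_zero]
      simpa [sameLast, hs] using hx
  have hUs := inner_U_left t s (j t k n h) (diagVec t K)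
  rw [hinv] at hUs
  rw [← hUs, inner_diagVec, integral_congr_ae hF, integral_word_succ t (hint.congr hF),
    inner_diagVec]
  refine integral_congr_ae (Filter.Eventually.of_forall fun x => ?_)
  have h3 := integral_single_letter t (x i) (K (Fin.last n) + k)
    (weightMonomial t (Fin.init K : Fin n → ℕ) x * (starRingEnd ℂ) (h (x, x)))
  have h4 := weightMonomial_update t (Fin.init K : Fin n → ℕ) i (K (Fin.last n) + k + 1) x
  simp only [F, weightMonomial_snoc, Fin.snoc_last, Fin.init_snoc, Fin.snoc_castSucc, map_mul,
    Complex.conj_ofReal]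
  have h5 : (Fin.init K : Fin n → ℕ) i = K i.castSucc := rfl
  rw [← h5, h4]
  refine Eq.trans (integral_congr_ae (Filter.Eventually.of_forall fun z => ?_)) (h3.trans (by ring))
  dsimp only
  refine ite_congr rfl (fun _ => ?_) fun _ => rfl
  simp only [pow_add, Complex.ofReal_mul]
  split_ifs <;> simp <;> ring

end Contraction

/-! ### Creation and annihilation on symmetrized diagonal vectors -/

section Levels

variable (t : ThomaParam) {ι : Type*} {n : ℕ}

theorem tensorMap_apply_of_notMem {A B E F : Type*} [NormedAddCommGroup E] [InnerProductSpace ℂ E]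
    [NormedAddCommGroup F] [InnerProductSpace ℂ F] (r : A → B) (hr : Function.Injective r)
    (T : E →L[ℂ] F) (f : lp (fun _ : A => E) 2) {b : B} (hb : ¬∃ a, r a = b) :
    tensorMap r hr T f b = 0 :=
  Function.extend_apply' (fun a => T (f a)) (0 : B → F) b hb

theorem tensorMap_single {A B E F : Type*} [DecidableEq A] [DecidableEq B] [NormedAddCommGroup E]
    [InnerProductSpace ℂ E] [NormedAddCommGroup F] [InnerProductSpace ℂ F] (r : A → B)
    (hr : Function.Injective r) (T : E →L[ℂ] F) (a : A) (v : E) :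
    tensorMap r hr T (lp.single 2 a v) = lp.single 2 (r a) (T v) := by
  ext1
  funext b
  by_cases hb : ∃ a', r a' = b
  · obtain ⟨a', rfl⟩ := hb
    rw [tensorMap_apply, lp.single_apply, lp.single_apply]
    by_cases h : a' = a
    · subst h; simp
    · rw [Pi.single_eq_of_ne h, Pi.single_eq_of_ne (hr.ne h), map_zero]
  · rw [tensorMap_apply_of_notMem r hr T _ hb, lp.single_apply,
      Pi.single_eq_of_ne (fun h => hb ⟨a, h.symm⟩)]

/-- The operator `v ⊗ η ↦ j v ⊗ (η ⊗ e_a)`. -/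
noncomputable def appendOp (k : ℕ) (a : ι) (n : ℕ) : VTensor t ι n →L[ℂ] VTensor t ι (n + 1) :=
  tensorMap (fun c : Fin n → ι => (Fin.snoc c a : Fin (n + 1) → ι)) (snoc_injective_left n a)
    (j t k n)

theorem coe_creationLevel (k : ℕ) (a : ι) (f : symSpace t ι n) :
    (creationLevel t k a n f : VTensor t ι (n + 1)) =
      ((n + 1 : ℕ) : ℂ) • symmetrizator t ι (n + 1) (appendOp t k a n f) := rfl

open Classical in
theorem appendOp_apply (k : ℕ) (a : ι) (f : VTensor t ι n) (d : Fin (n + 1) → ι) :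
    appendOp t k a n f d = if d (Fin.last n) = a then j t k n (f (Fin.init d)) else 0 := by
  split_ifs with h
  · have hd : d = (Fin.snoc (Fin.init d : Fin n → ι) a : Fin (n + 1) → ι) := by
      rw [← h]; exact (Fin.snoc_init_self d).symm
    have := tensorMap_apply (fun c : Fin n → ι => (Fin.snoc c a : Fin (n + 1) → ι))
      (snoc_injective_left n a) (j t k n) f (Fin.init d)
    dsimp only at this
    rw [← hd] at this
    exact this
  · refine tensorMap_apply_of_notMem _ _ _ _ ?_
    rintro ⟨c, rfl⟩
    exact h (by simp)

theorem appendOp_permOp (k : ℕ) (a : ι) (σ : Equiv.Perm (Fin n)) (f : VTensor t ι n) :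
    appendOp t k a n (permOp t ι σ f) = permOp t ι (extendPerm σ) (appendOp t k a n f) := by
  classical
  ext1
  funext d
  rw [permOp_apply, appendOp_apply, appendOp_apply, permOp_apply, Function.comp_apply,
    extendPerm_last]
  split_ifs
  · rw [j_U, init_comp_extendPerm]
  · rw [map_zero]

open Classical in
theorem permOp_single (σ : Equiv.Perm (Fin n)) (c : Fin n → ι) (v : V t n) :
    permOp t ι σ (lp.single 2 c v) = lp.single 2 (c ∘ ⇑σ⁻¹) (U t σ v) :=
  tensorMap_single _ _ _ _ _

theorem symmetrizator_permOp (σ : Equiv.Perm (Fin n)) (f : VTensor t ι n) :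
    symmetrizator t ι n (permOp t ι σ f) = symmetrizator t ι n f := by
  simp only [symmetrizator, smul_apply, sum_apply, ← permOp_mul]
  congr 1
  exact Fintype.sum_equiv (Equiv.mulRight σ) _ _ fun τ => rfl

/-- The sum of the orbit of a vector. -/
noncomputable def symSum (f : VTensor t ι n) : symSpace t ι n :=
  ⟨∑ τ : Equiv.Perm (Fin n), permOp t ι τ f, by
    have h : ∑ τ : Equiv.Perm (Fin n), permOp t ι τ f =
        (n.factorial : ℂ) • symmetrizator t ι n f := by
      rw [symmetrizator, smul_apply, sum_apply, smul_smul,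
        mul_inv_cancel₀ (Nat.cast_ne_zero.2 n.factorial_ne_zero), one_smul]
    rw [h]
    exact Submodule.smul_mem _ _ (symmetrizator_mem t ι n f)⟩

theorem coe_symSum (f : VTensor t ι n) :
    (symSum t f : VTensor t ι n) = ∑ τ : Equiv.Perm (Fin n), permOp t ι τ f := rfl

theorem inner_symSum (g : symSpace t ι n) (f : VTensor t ι n) :
    ⟪g, symSum t f⟫_ℂ = (n.factorial : ℂ) * ⟪(g : VTensor t ι n), f⟫_ℂ := by
  rw [Submodule.coe_inner, coe_symSum, inner_sum]
  have h : ∀ τ : Equiv.Perm (Fin n), ⟪(g : VTensor t ι n), permOp t ι τ f⟫_ℂ =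
      ⟪(g : VTensor t ι n), f⟫_ℂ := by
    intro τ
    have h1 := inner_permOp_left t τ⁻¹ (g : VTensor t ι n) f
    rw [inv_inv, mem_symSpace.1 g.2] at h1
    exact h1.symm
  simp only [h, Finset.sum_const, Finset.card_univ, Fintype.card_perm, Fintype.card_fin,
    nsmul_eq_mul]

/-- Orbit sums, rather than averages, absorb all factorials: `(n + 1) * n! / (n + 1)! = 1`. -/
theorem creationLevel_symSum (k : ℕ) (a : ι) (f : VTensor t ι n) :
    creationLevel t k a n (symSum t f) = symSum t (appendOp t k a n f) := by
  ext1
  rw [coe_creationLevel, coe_symSum, coe_symSum, map_sum, map_sum]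
  simp only [appendOp_permOp, symmetrizator_permOp, Finset.sum_const, Finset.card_univ,
    Fintype.card_perm, Fintype.card_fin]
  rw [symmetrizator, smul_apply, sum_apply, ← Nat.cast_smul_eq_nsmul ℂ, smul_smul, smul_smul,
    ← Nat.cast_mul, ← Nat.factorial_succ,
    mul_inv_cancel₀ (Nat.cast_ne_zero.2 (n + 1).factorial_ne_zero), one_smul]

open Classical in
/-- The symmetrization of `δ(x, y) ∏ a(x_i) ^ K_i ⊗ e_{c 1} ⊗ ⋯ ⊗ e_{c n}`. -/
noncomputable def symVec (c : Fin n → ι) (K : Fin n → ℕ) : symSpace t ι n :=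
  symSum t (lp.single 2 c (diagVec t K))

theorem inner_symVec (g : symSpace t ι n) (c : Fin n → ι) (K : Fin n → ℕ) :
    ⟪g, symVec t c K⟫_ℂ = (n.factorial : ℂ) * ⟪(g : VTensor t ι n) c, diagVec t K⟫_ℂ := by
  classical
  rw [symVec, inner_symSum, lp.inner_single_right]

theorem creationLevel_symVec (k : ℕ) (a : ι) (c : Fin n → ι) (K : Fin n → ℕ) :
    creationLevel t k a n (symVec t c K) =
      symVec t (Fin.snoc c a : Fin (n + 1) → ι) (Fin.snoc K k : Fin (n + 1) → ℕ) := by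
  classical
  rw [symVec, creationLevel_symSum, symVec, appendOp, tensorMap_single, j_diagVec]

/-- The factor `n + 1` of the creation operator cancels against the scaling, and the symmetrizator
can be moved onto the invariant vector `f`, which it fixes. -/
theorem inner_annihilationLevel (k : ℕ) (a : ι) (g : symSpace t ι n) (f : symSpace t ι (n + 1)) :
    ⟪g, annihilationLevel t k a n f⟫_ℂ =
      ⟪appendOp t k a n g, (f : VTensor t ι (n + 1))⟫_ℂ := by
  have h0 : ((n + 1 : ℕ) : ℂ) ≠ 0 := Nat.cast_ne_zero.2 (Nat.succ_ne_zero n)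
  have h1 : ⟪creationLevel t k a n g, f⟫_ℂ = ((n + 1 : ℕ) : ℂ) *
      ⟪symmetrizator t ι (n + 1) (appendOp t k a n g), (f : VTensor t ι (n + 1))⟫_ℂ := by
    rw [Submodule.coe_inner, coe_creationLevel, inner_smul_left, Complex.conj_natCast]
  rw [annihilationLevel, inner_smul_adjoint, h1, inv_mul_cancel_left₀ h0, symmetrizator,
    smul_apply, sum_apply, inner_smul_left, sum_inner]
  simp only [inner_permOp_left, mem_symSpace.1 f.2, Finset.sum_const, Finset.card_univ,
    Fintype.card_perm, Fintype.card_fin, nsmul_eq_mul, map_inv₀, Complex.conj_natCast]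
  exact inv_mul_cancel_left₀ (Nat.cast_ne_zero.2 (n + 1).factorial_ne_zero) _

theorem extendPerm_injective : Function.Injective (extendPerm : Equiv.Perm (Fin n) → _) := by
  intro σ τ h
  ext1 i
  have := DFunLike.congr_fun h i.castSucc
  rw [extendPerm_castSucc, extendPerm_castSucc] at this
  exact Fin.castSucc_injective n this

/-- The transpositions of the last point are representatives of the cosets of the permutations
fixing the last point. -/
theorem bijective_extendPerm_mul_swap :
    Function.Bijective fun e : Equiv.Perm (Fin n) × Fin (n + 1) =>
      extendPerm e.1 * Equiv.swap e.2 (Fin.last n) := by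
  rw [Fintype.bijective_iff_injective_and_card]
  constructor
  · rintro ⟨σ, i⟩ ⟨τ, l⟩ h
    dsimp only at h
    have h1 := DFunLike.congr_fun h i
    rw [Equiv.Perm.mul_apply, Equiv.swap_apply_left, extendPerm_last, Equiv.Perm.mul_apply] at h1
    have h2 : i = l := (Equiv.swap l (Fin.last n)).injective ((extendPerm τ).injective (by
      rw [← h1, Equiv.swap_apply_left, extendPerm_last]))
    subst h2
    rw [extendPerm_injective (mul_right_cancel h)]
  · rw [Fintype.card_prod, Fintype.card_perm, Fintype.card_perm, Fintype.card_fin,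
      Fintype.card_fin, Nat.factorial_succ, mul_comm]

theorem extendPerm_inv (σ : Equiv.Perm (Fin n)) : (extendPerm σ)⁻¹ = extendPerm σ⁻¹ := rfl

/-- The orbit sum is split along the cosets of `S_n`. Permutations fixing the last point pass
through the appending operator onto the invariant vector `g` and disappear, leaving `n!` times the
sum over the transpositions. -/
theorem inner_appendOp_symSum (k : ℕ) (a : ι) (g : symSpace t ι n) (f : VTensor t ι (n + 1)) :
    ⟪appendOp t k a n g, (symSum t f : VTensor t ι (n + 1))⟫_ℂ = (n.factorial : ℂ) *
      ∑ i, ⟪appendOp t k a n g, permOp t ι (Equiv.swap i (Fin.last n)) f⟫_ℂ := by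
  rw [coe_symSum, inner_sum, ← (Equiv.ofBijective _ (bijective_extendPerm_mul_swap
    (n := n))).sum_comp, Fintype.sum_prod_type]
  have h : ∀ (σ : Equiv.Perm (Fin n)) (f' : VTensor t ι (n + 1)),
      ⟪appendOp t k a n g, permOp t ι (extendPerm σ) f'⟫_ℂ = ⟪appendOp t k a n g, f'⟫_ℂ := by
    intro σ f'
    have h1 := inner_permOp_left t (extendPerm σ⁻¹) (appendOp t k a n g) f'
    rw [← appendOp_permOp, mem_symSpace.1 g.2, extendPerm_inv, inv_inv] at h1
    exact h1.symm
  simp only [Equiv.ofBijective_apply, permOp_mul, h, Finset.sum_const, Finset.card_univ,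
    Fintype.card_perm, Fintype.card_fin, nsmul_eq_mul]

open Classical in
/-- The action of the annihilation operators on symmetrized diagonal vectors. -/
theorem annihilationLevel_symVec (k : ℕ) (a : ι) (c : Fin (n + 1) → ι) (K : Fin (n + 1) → ℕ) :
    annihilationLevel t k a n (symVec t c K) =
      (if c (Fin.last n) = a then (thomaVariable t (K (Fin.last n) + k + 1) : ℂ) •
        symVec t (Fin.init c : Fin n → ι) (Fin.init K : Fin n → ℕ) else 0) +
      ∑ i : Fin n, if c i.castSucc = a then
        symVec t (Function.update (Fin.init c : Fin n → ι) i (c (Fin.last n)))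
          (Function.update (Fin.init K : Fin n → ℕ) i
            (K i.castSucc + (K (Fin.last n) + k + 1))) else 0 := by
  refine ext_inner_left ℂ fun g => ?_
  rw [inner_annihilationLevel, symVec, inner_appendOp_symSum, Fin.sum_univ_castSucc, add_comm,
    inner_add_right, inner_sum, mul_add, Finset.mul_sum]
  congr 1
  · rw [Equiv.swap_self, ← Equiv.Perm.one_def, permOp_one, lp.inner_single_right, appendOp_apply]
    split_ifs with h
    · rw [inner_j_diagVec]
      have hr := inner_smul_right (𝕜 := ℂ) g (symVec t (Fin.init c : Fin n → ι)
        (Fin.init K : Fin n → ℕ)) (thomaVariable t (K (Fin.last n) + k + 1) : ℂ)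
      refine Eq.trans ?_ hr.symm
      rw [inner_symVec]
      ring
    · rw [inner_zero_left, inner_zero_right, mul_zero]
  · refine Finset.sum_congr rfl fun i _ => ?_
    -- After the transposition the colour `c_i` stands last and is the one compared with `a`, while
    -- position `i` receives the colour of the former last particle.
    rw [permOp_single, lp.inner_single_right, appendOp_apply, Equiv.swap_inv, Function.comp_apply,
      Equiv.swap_apply_right]
    split_ifs with h
    · have hc : (Fin.init (c ∘ Equiv.swap i.castSucc (Fin.last n)) : Fin n → ι) =
          Function.update (Fin.init c : Fin n → ι) i (c (Fin.last n)) := ?_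
      · rw [inner_j_U_swap, inner_symVec, hc]
      funext l
      by_cases hl : l = i
      · subst hl; simp [Fin.init]
      · have h1 : l.castSucc ≠ i.castSucc := fun h => hl (Fin.castSucc_injective n h)
        simp [Fin.init, hl, Equiv.swap_apply_of_ne_of_ne h1 (Fin.castSucc_lt_last l).ne]
    · rw [inner_zero_left, inner_zero_right, mul_zero]

theorem vacuum_eq : vacuum t ι = DirectSum.lof ℂ ℕ (fun n => symSpace t ι n) 0
    (symVec t Fin.elim0 Fin.elim0) := by
  classical
  have hv : (indicatorConstLp 2 MeasurableSet.univ (measure_ne_top _ _) 1 : V t 0) =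
      diagVec t Fin.elim0 := by
    refine Lp.ext ?_
    filter_upwards [coeFn_diagVec t Fin.elim0, indicatorConstLp_coeFn (E := ℂ)
      (μ := pairMeasure t 0) (p := 2) (hs := MeasurableSet.univ) (hμs := measure_ne_top _ _)
      (c := (1 : ℂ))] with p h1 h2
    rw [h1, h2, Set.indicator_of_mem (Set.mem_univ p),
      Set.indicator_of_mem (Set.mem_diagonal_iff.2 (Subsingleton.elim _ _))]
    simp [weightMonomial]
  rw [vacuum]
  congr 1
  ext1
  rw [symVec, coe_symSum, Fintype.sum_unique]
  change _ = permOp t ι 1 _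
  rw [permOp_one, ← hv]

theorem inner_diagVec_zero (K : Fin 0 → ℕ) : ⟪diagVec t K, diagVec t K⟫_ℂ = 1 := by
  rw [inner_diagVec]
  have h : ∀ᵐ x ∂wordMeasure t 0, weightMonomial t K x *
      (starRingEnd ℂ) (diagVec t K (x, x)) = 1 := by
    filter_upwards [ae_diag t (coeFn_diagVec t K)] with x hx
    rw [hx, Set.indicator_of_mem (Set.mem_diagonal_iff.2 rfl)]
    simp [weightMonomial]
  rw [integral_congr_ae h]
  simp

theorem fockInner_vacuum (f : Fock t ι) :
    fockInner (vacuum t ι) f = ⟪symVec t Fin.elim0 Fin.elim0, f 0⟫_ℂ := by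
  classical
  rw [fockInner, finsum_eq_single _ 0]
  · rw [vacuum_eq, DirectSum.lof_apply]
    simp
  · intro n hn
    rw [vacuum_eq, DirectSum.lof_eq_of, DirectSum.of_eq_of_ne _ _ _ hn, inner_zero_left, mul_zero]

theorem fockInner_vacuum_symVec_zero (c : Fin 0 → ι) (K : Fin 0 → ℕ) :
    fockInner (vacuum t ι) (DirectSum.lof ℂ ℕ (fun n => symSpace t ι n) 0 (symVec t c K)) = 1 := by
  classical
  obtain rfl : c = Fin.elim0 := Subsingleton.elim _ _
  obtain rfl : K = Fin.elim0 := Subsingleton.elim _ _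
  rw [fockInner_vacuum, DirectSum.lof_apply, symVec, inner_symSum, coe_symSum,
    Fintype.sum_unique]
  change _ * ⟪permOp t ι 1 _, _⟫_ℂ = 1
  rw [permOp_one, lp.inner_single_right, lp.single_apply_self, inner_diagVec_zero]
  simp

end Levels

/-! ### Matching the evaluation of a word with the contraction of its digraph -/

section Evaluation

variable {ι : Type*} {n : ℕ}

/-- The operator of one letter of a word. -/
noncomputable def letterOp (t : ThomaParam) (ε : Fin (2 * n) → Bool) (i : Fin (2 * n) → ι)
    (k : Fin (2 * n) → ℕ) (p : Fin (2 * n)) : Module.End ℂ (Fock t ι) :=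
  if ε p = true then annihilation t (k p) (i p) else creation t (k p) (i p)

/-- The product of the first `m` letters of a word. -/
noncomputable def prefixOp (t : ThomaParam) (ε : Fin (2 * n) → Bool) (i : Fin (2 * n) → ι)
    (k : Fin (2 * n) → ℕ) (m : ℕ) : Module.End ℂ (Fock t ι) :=
  ((List.ofFn (letterOp t ε i k)).take m).prod

theorem prefixOp_succ (t : ThomaParam) (ε : Fin (2 * n) → Bool) (i : Fin (2 * n) → ι)
    (k : Fin (2 * n) → ℕ) (p : Fin (2 * n)) :
    prefixOp t ε i k (p + 1) = prefixOp t ε i k p * letterOp t ε i k p := by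
  rw [prefixOp, prefixOp, List.prod_take_succ _ _ (by simp)]
  simp

theorem prefixOp_length (t : ThomaParam) (ε : Fin (2 * n) → Bool) (i : Fin (2 * n) → ι)
    (k : Fin (2 * n) → ℕ) : prefixOp t ε i k (2 * n) = wordOp t ε i k := by
  rw [prefixOp, List.take_of_length_le (by simp)]
  rfl

theorem creation_lof (t : ThomaParam) (k : ℕ) (a : ι) (N : ℕ) (f : symSpace t ι N) :
    creation t k a (DirectSum.lof ℂ ℕ (fun n => symSpace t ι n) N f) =
      DirectSum.lof ℂ ℕ (fun n => symSpace t ι n) (N + 1) (creationLevel t k a N f) := by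
  classical
  rw [creation, raise, DirectSum.toModule_lof]
  rfl

theorem annihilation_lof_succ (t : ThomaParam) (k : ℕ) (a : ι) (N : ℕ)
    (f : symSpace t ι (N + 1)) :
    annihilation t k a (DirectSum.lof ℂ ℕ (fun n => symSpace t ι n) (N + 1) f) =
      DirectSum.lof ℂ ℕ (fun n => symSpace t ι n) N (annihilationLevel t k a N f) := by
  classical
  rw [annihilation, lower, DirectSum.toModule_lof]
  rfl

theorem fockInner_add_right {t : ThomaParam} (f g : Fock t ι) :
    fockInner (vacuum t ι) (f + g) = fockInner (vacuum t ι) f + fockInner (vacuum t ι) g := by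
  simp only [fockInner_vacuum, DirectSum.add_apply, inner_add_right]

/-- The vacuum functional `f ↦ ⟨Ω, f⟩`. -/
noncomputable def vacuumFunctional (t : ThomaParam) (ι : Type*) : Fock t ι →ₗ[ℂ] ℂ where
  toFun f := fockInner (vacuum t ι) f
  map_add' := fockInner_add_right
  map_smul' c f := by
    simp only [fockInner_vacuum, RingHom.id_apply, smul_eq_mul]
    exact inner_smul_right (𝕜 := ℂ) _ _ _

/-- The annihilators among the first `m` letters. -/
abbrev AnnihilatorsBelow (ε : Fin (2 * n) → Bool) (m : ℕ) : Type :=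
  {p : Fin (2 * n) // ε p = true ∧ p.val < m}

/-- The vectors `symVec` as elements of the Fock space. -/
noncomputable def fockVec (t : ThomaParam) {N : ℕ} (c : Fin N → ι) (K : Fin N → ℕ) : Fock t ι :=
  DirectSum.lof ℂ ℕ (fun n => symSpace t ι n) N (symVec t c K)

theorem creation_fockVec (t : ThomaParam) (k : ℕ) (a : ι) {N : ℕ} (c : Fin N → ι)
    (K : Fin N → ℕ) : creation t k a (fockVec t c K) =
      fockVec t (Fin.snoc c a : Fin (N + 1) → ι) (Fin.snoc K k : Fin (N + 1) → ℕ) := by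
  rw [fockVec, creation_lof, creationLevel_symVec, fockVec]

open Classical in
theorem annihilation_fockVec (t : ThomaParam) (k : ℕ) (a : ι) {N : ℕ} (c : Fin (N + 1) → ι)
    (K : Fin (N + 1) → ℕ) : annihilation t k a (fockVec t c K) =
      (if c (Fin.last N) = a then (thomaVariable t (K (Fin.last N) + k + 1) : ℂ) •
        fockVec t (Fin.init c : Fin N → ι) (Fin.init K : Fin N → ℕ) else 0) +
      ∑ l : Fin N, if c l.castSucc = a then
        fockVec t (Function.update (Fin.init c : Fin N → ι) l (c (Fin.last N)))
          (Function.update (Fin.init K : Fin N → ℕ) l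
            (K l.castSucc + (K (Fin.last N) + k + 1))) else 0 := by
  rw [fockVec, annihilation_lof_succ, annihilationLevel_symVec, map_add, map_sum]
  congr 1
  · split_ifs
    · exact map_smul _ _ _
    · exact map_zero _
  · refine Finset.sum_congr rfl fun l _ => ?_
    split_ifs
    · rfl
    · exact map_zero _

theorem comp_init {α β : Type*} {N : ℕ} (f : α → β) (B : Fin (N + 1) → α) :
    (Fin.init (f ∘ B) : Fin N → β) = f ∘ (Fin.init B : Fin N → α) := rfl

/-- The vertices `p < m + 1`, where the annihilator at `m` is singled out. -/
def annihilatorsBelowSucc (ε : Fin (2 * n) → Bool) (q : Fin (2 * n)) (hq : ε q = true) :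
    Option (AnnihilatorsBelow ε q) ≃ AnnihilatorsBelow ε (q + 1) where
  toFun := fun o => o.elim ⟨q, hq, Nat.lt_succ_self _⟩ fun p =>
    ⟨p.1, p.2.1, p.2.2.trans (Nat.lt_succ_self _)⟩
  invFun := fun p => if h : p.1.val < q then some ⟨p.1, p.2.1, h⟩ else none
  left_inv := by
    rintro (_ | p)
    · simp
    · simp [p.2.2]
  right_inv := by
    rintro ⟨p, hp, hpq⟩
    by_cases h : p.val < q.val
    · simp [h]
    · have : p = q := Fin.ext (by omega)
      subst this
      simp

/-- If the letter at `m` is a creator, the vertices `p < m` and `p < m + 1` are the same. -/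
def annihilatorsBelowEquiv (ε : Fin (2 * n) → Bool) (q : Fin (2 * n)) (hq : ¬ε q = true) :
    AnnihilatorsBelow ε q ≃ AnnihilatorsBelow ε (q + 1) :=
  Equiv.subtypeEquivRight fun p => and_congr_right fun hp => by
    have : p ≠ q := by rintro rfl; exact hq hp
    rw [Ne, Fin.ext_iff] at this
    omega

/-- Letters act from the right, so the prefix of length `m` meets a state left by the later letters.
`B` lists the pending creators, those from `m` on whose partners are still to act, in order of
creation; its last entry is thus the leftmost position. Exchange terms change colours and exponents
of pending particles, so `c` and `K` are arbitrary there and agree with the word only below `m`.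
With this freedom, the contracted digraph is again a digraph of the same kind for the shorter
prefix. -/
theorem vacuum_prefixOp_fockVec (t : ThomaParam) {ε : Fin (2 * n) → Bool} (i : Fin (2 * n) → ι)
    (k : Fin (2 * n) → ℕ) {π : Equiv.Perm (Fin (2 * n))} (hπ : IsNoncrossingPairing ε π) :
    ∀ m ≤ 2 * n, ∀ (N : ℕ) (B : Fin N → Fin (2 * n)), StrictAnti B →
      (∀ b, (∃ l, B l = b) ↔ m ≤ b.val ∧ (π b).val < m) →
      ∀ (c : Fin (2 * n) → ι) (K : Fin (2 * n) → ℕ),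
        (∀ b : Fin (2 * n), b.val < m → c b = i b ∧ K b = k b) →
      vacuumFunctional t ι (prefixOp t ε i k m (fockVec t (c ∘ B) (K ∘ B))) =
        permSum (fun r => (thomaVariable t r : ℂ))
          (fun r s : AnnihilatorsBelow ε m => i r = c (π s) ∧ r.val < π s)
          (fun v => k v + 1 + K (π v)) := by
  classical
  have hinv := hπ.involutive
  intro m
  induction m with
  | zero =>
    intro _ N B hB hrange c K _
    have hN : N = 0 := by
      by_contra hN
      have := (hrange _).1 ⟨⟨0, Nat.pos_of_ne_zero hN⟩, rfl⟩
      omega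
    subst hN
    have : IsEmpty (AnnihilatorsBelow ε 0) := ⟨fun p => absurd p.2.2 (Nat.not_lt_zero _)⟩
    rw [permSum_of_isEmpty, prefixOp, List.take_zero, List.prod_nil, Module.End.one_apply]
    exact fockInner_vacuum_symVec_zero t _ _
  | succ m ih =>
    intro hm N B hB hrange c K hcK
    let q : Fin (2 * n) := ⟨m, hm⟩
    have hq := prefixOp_succ t ε i k q
    have hqv : q.val = m := rfl
    rw [hqv] at hq
    rw [hq, Module.End.mul_apply, letterOp]
    by_cases hεq : ε q = true
    · have hlt : q < π q := (hπ.left_iff q).1 hεq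
      rw [if_pos hεq]
      obtain ⟨l₀, hl₀⟩ := (hrange (π q)).2 ⟨hlt, by rw [hinv]; exact Nat.lt_succ_self m⟩
      obtain ⟨N, rfl⟩ : ∃ N', N = N' + 1 := ⟨N - 1, by have := l₀.2; omega⟩
      -- A pending creator to the left of `π q` would have its partner to the left of `q`, and the
      -- two arcs would cross.
      have hlast : B (Fin.last N) = π q := by
        refine le_antisymm (hl₀ ▸ hB.antitone (Fin.le_last l₀)) (not_lt.1 fun h => ?_)
        obtain ⟨h1, h2⟩ := (hrange _).1 ⟨Fin.last N, rfl⟩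
        have h3 : π (B (Fin.last N)) ≠ q := fun h' => by
          rw [← h', hinv] at h
          exact lt_irrefl _ h
        have h4 : π (B (Fin.last N)) < q := by
          rw [Ne, Fin.ext_iff] at h3
          rw [Fin.lt_def]; omega
        refine hπ.noncrossing (π (B (Fin.last N))) q ⟨h4, ?_, ?_⟩
        · rw [hinv, Fin.lt_def]; omega
        · rw [hinv]; exact h
      have hB' : StrictAnti (Fin.init B : Fin N → Fin (2 * n)) := fun a b hab =>
        hB (Fin.castSucc_lt_castSucc_iff.2 hab)
      have hrange' : ∀ b, (∃ l, (Fin.init B : Fin N → Fin (2 * n)) l = b) ↔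
          m ≤ b.val ∧ (π b).val < m := by
        intro b
        constructor
        · rintro ⟨l, rfl⟩
          obtain ⟨h1, h2⟩ := (hrange _).1 ⟨l.castSucc, rfl⟩
          have h3 : π (B l.castSucc) ≠ q := fun h => by
            rw [← h, hinv] at hlast
            exact (Fin.castSucc_lt_last l).ne' (hB.injective hlast)
          rw [Ne, Fin.ext_iff] at h3
          simp only [Fin.init]
          omega
        · rintro ⟨h1, h2⟩
          have h3 : b ≠ q := by
            rintro rfl
            rw [Fin.lt_def] at hlt
            omega
          rw [Ne, Fin.ext_iff] at h3
          obtain ⟨l, hl⟩ := (hrange b).2 ⟨by omega, by omega⟩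
          refine ⟨l.castPred fun h => ?_, by simpa [Fin.init] using hl⟩
          rw [h, hlast] at hl
          rw [← hl, hinv] at h2
          exact lt_irrefl _ h2
      have hBgt : ∀ l, m < (B l).val := fun l => ((hrange _).1 ⟨l, rfl⟩).1
      rw [annihilation_fockVec, map_add, map_add, map_sum, map_sum,
        ← permSum_congr _ (annihilatorsBelowSucc ε q hεq) (fun _ _ => Iff.rfl) (fun _ => rfl),
        permSum_option]
      congr 1
      -- Removing the last particle corresponds to the loop at `q`: the order condition `q < π q`
      -- always holds.
      · have hadj : (i q = c (π q) ∧ q.val < π q) ↔ c (B (Fin.last N)) = i q := by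
          rw [hlast, eq_comm]
          exact and_iff_left hlt
        simp only [Function.comp_apply]
        by_cases h : c (B (Fin.last N)) = i q
        · rw [if_pos h]
          refine Eq.trans ?_ (if_pos (hadj.2 h)).symm
          rw [map_smul, map_smul, comp_init, comp_init,
            ih (by omega) N _ hB' hrange' c K fun b hb => hcK b (by omega), smul_eq_mul]
          congr 2
          simp only [annihilatorsBelowSucc, Equiv.coe_fn_mk, Option.elim, hlast]
          congr 1
          omega
        · rw [if_neg h, map_zero, map_zero]
          exact (if_neg (mt hadj.1 h)).symm
      -- The remaining particles correspond to the possible targets of edges from `q`, namely the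
      -- earlier annihilators whose partners lie to the right of `q`.
      · let e : Fin N → AnnihilatorsBelow ε q := fun l =>
          ⟨π (B l.castSucc), by
            have h := (hrange' (B l.castSucc)).1 ⟨l, rfl⟩
            refine ⟨(hπ.left_iff _).2 ?_, h.2⟩
            rw [hinv, Fin.lt_def]; omega⟩
        have he : Function.Injective e := fun l l' h =>
          Fin.castSucc_injective N (hB.injective (π.injective (Subtype.ext_iff.1 h)))
        refine Finset.sum_of_injOn e he.injOn (fun _ _ => Finset.mem_univ _) ?_ ?_
        · intro s _ hs
          refine if_neg ?_
          rintro ⟨-, h2⟩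
          refine hs ?_
          obtain ⟨l, hl⟩ := (hrange' (π s)).2 ⟨le_of_lt h2, by rw [hinv]; exact s.2.2⟩
          refine ⟨l, Finset.mem_coe.2 (Finset.mem_univ _), Subtype.ext ?_⟩
          change π (B l.castSucc) = s
          have hl' : B l.castSucc = π s := hl
          rw [hl', hinv]
        · intro l _
          have hadj : (i q = c (π (π (B l.castSucc))) ∧ q.val < (π (π (B l.castSucc))).val) ↔
              c (B l.castSucc) = i q := by
            rw [hinv, eq_comm]
            exact and_iff_left (hBgt _)
          simp only [Function.comp_apply]
          by_cases h : c (B l.castSucc) = i q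
          · rw [if_pos h]
            refine Eq.trans ?_ (if_pos (hadj.2 h)).symm
            have hinj : Function.Injective (Fin.init B : Fin N → Fin (2 * n)) := hB'.injective
            have hup : ∀ {α : Type _} (f : Fin (2 * n) → α) (y : α),
                Function.update (f ∘ (Fin.init B : Fin N → Fin (2 * n))) l y =
                Function.update f (B l.castSucc) y ∘ (Fin.init B : Fin N → Fin (2 * n)) := by
              intro α f y
              exact (Function.update_comp_eq_of_injective f hinj l y).symm
            have hup' : ∀ (f : Fin (2 * n) → ℕ) (y : ℕ),
                Function.update (f ∘ (Fin.init B : Fin N → Fin (2 * n))) l y =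
                Function.update f (B l.castSucc) y ∘ (Fin.init B : Fin N → Fin (2 * n)) := by
              intro f y
              exact (Function.update_comp_eq_of_injective f hinj l y).symm
            rw [comp_init, comp_init, hup, hup', ih (by omega) N _ hB' hrange']
            -- The particle at `B l` now has the colour of `π q`, as the edges into the merged
            -- vertex are those into `q`. The order conditions for these edges hold automatically,
            -- because every remaining vertex lies to the left of `q`. Its new exponent includes `k
            -- q + 1 + K (π q)`, the weight of `q`.
            · refine permSum_congr _ (Equiv.refl _) (fun u v => ?_) fun v => ?_
              · by_cases hv : v = e l
                · subst hv
                  have h1 : π (e l).1 = B l.castSucc := hinv _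
                  have h2 := u.2.2
                  have h3 := hBgt l.castSucc
                  have h4 : u.1.val < (π q).val := h2.trans hlt
                  simp only [Equiv.refl_apply, if_true, h1, Function.update_self, hlast]
                  refine and_congr_right fun _ => iff_of_true ?_ h4
                  rw [Fin.lt_def]; omega
                · have h1 : π v.1 ≠ B l.castSucc := fun h' => hv (Subtype.ext (by
                    change v.1 = π (B l.castSucc)
                    rw [← h', hinv]))
                  simp only [Equiv.refl_apply, hv, if_false, Function.update_of_ne h1]
                  rfl
              · by_cases hv : v = e l
                · subst hv
                  have h1 : π (e l).1 = B l.castSucc := hinv _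
                  simp only [Equiv.refl_apply, if_true, h1, Function.update_self,
                    annihilatorsBelowSucc, Equiv.coe_fn_mk, Option.elim, hlast]
                  omega
                · have h1 : π v.1 ≠ B l.castSucc := fun h' => hv (Subtype.ext (by
                    change v.1 = π (B l.castSucc)
                    rw [← h', hinv]))
                  simp only [Equiv.refl_apply, hv, if_false, Function.update_of_ne h1, add_zero]
                  rfl
            · intro b hb
              have h1 : b ≠ B l.castSucc := by
                rintro rfl
                have := hBgt l.castSucc
                omega
              rw [Function.update_of_ne h1, Function.update_of_ne h1]
              exact hcK b (by omega)
          · rw [if_neg h, map_zero, map_zero]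
            exact (if_neg (mt hadj.1 h)).symm
    · have hlt : π q < q := lt_of_le_of_ne (not_lt.1 fun h => hεq ((hπ.left_iff q).2 h))
        (hπ.ne_self q)
      have hBgt : ∀ l, m < (B l).val := fun l => ((hrange _).1 ⟨l, rfl⟩).1
      have hsnoc : ∀ {α : Type _} (f : Fin (2 * n) → α),
          (Fin.snoc (f ∘ B) (f q) : Fin (N + 1) → α) =
            f ∘ (Fin.snoc B q : Fin (N + 1) → Fin (2 * n)) := fun f => (Fin.comp_snoc f B q).symm
      have hsnoc' : ∀ (f : Fin (2 * n) → ℕ),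
          (Fin.snoc (f ∘ B) (f q) : Fin (N + 1) → ℕ) =
            f ∘ (Fin.snoc B q : Fin (N + 1) → Fin (2 * n)) := fun f => (Fin.comp_snoc f B q).symm
      obtain ⟨hc, hK⟩ := hcK q (Nat.lt_succ_self m)
      -- A creator adds its own position to the pending ones; it is to the left of all of them,
      -- hence comes last, and the set of vertices does not change.
      rw [if_neg hεq, creation_fockVec, ← hc, ← hK, hsnoc, hsnoc', ih (by omega)]
      · exact permSum_congr _ (annihilatorsBelowEquiv ε q hεq) (fun _ _ => Iff.rfl) fun _ => rfl
      · intro a b hab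
        revert hab
        refine Fin.lastCases ?_ (fun b => ?_) b
        · refine Fin.lastCases (fun h => absurd h (lt_irrefl _)) (fun a _ => ?_) a
          rw [Fin.snoc_last, Fin.snoc_castSucc, Fin.lt_def]
          exact hBgt a
        · refine Fin.lastCases (fun h => absurd h (Fin.castSucc_lt_last b).not_gt) (fun a h => ?_) a
          rw [Fin.snoc_castSucc, Fin.snoc_castSucc]
          exact hB (Fin.castSucc_lt_castSucc_iff.1 h)
      · intro b
        constructor
        · rintro ⟨l, rfl⟩
          refine Fin.lastCases ?_ (fun l => ?_) l
          · rw [Fin.snoc_last]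
            exact ⟨le_rfl, hlt⟩
          · rw [Fin.snoc_castSucc]
            obtain ⟨h1, h2⟩ := (hrange _).1 ⟨l, rfl⟩
            have h3 : π (B l) ≠ q := fun h => by
              rw [← h, hinv, Fin.lt_def] at hlt
              omega
            rw [Ne, Fin.ext_iff] at h3
            omega
        · rintro ⟨h1, h2⟩
          by_cases hb : b = q
          · exact ⟨Fin.last N, by rw [Fin.snoc_last, hb]⟩
          · rw [Fin.ext_iff] at hb
            obtain ⟨l, hl⟩ := (hrange b).2 ⟨by omega, by omega⟩
            exact ⟨l.castSucc, by rw [Fin.snoc_castSucc, hl]⟩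
      · intro b hb
        exact hcK b (by omega)

/-- For the whole word nothing is pending, and the general digraph becomes that of the word. -/
theorem vacuumExpectation_wordOp (t : ThomaParam) {ε : Fin (2 * n) → Bool} (i : Fin (2 * n) → ι)
    (k : Fin (2 * n) → ℕ) {π : Equiv.Perm (Fin (2 * n))} (hπ : IsNoncrossingPairing ε π) :
    vacuumExpectation (wordOp t ε i k) =
      permSum (fun r => (thomaVariable t r : ℂ)) (wordDigraph ε i π).Adj (wordWeight ε k π) := by
  have h := vacuum_prefixOp_fockVec t i k hπ (2 * n) le_rfl 0 Fin.elim0 (fun a => a.elim0)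
    (fun b => ⟨fun ⟨l, _⟩ => l.elim0, fun h => absurd b.2 (not_lt.2 h.1)⟩) i k
    fun _ _ => ⟨rfl, rfl⟩
  have hv : fockVec t (i ∘ Fin.elim0) (k ∘ Fin.elim0) = vacuum t ι := by
    rw [vacuum_eq, fockVec]
    congr 2 <;> exact Subsingleton.elim _ _
  rw [prefixOp_length, hv] at h
  refine Eq.trans h ?_
  exact permSum_congr _ (Equiv.subtypeEquivRight fun p => and_iff_left p.2)
    (fun _ _ => Iff.rfl) fun _ => rfl

end Evaluation

end ThomaFock

/-! ### The theorem -/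

theorem mainTheorem10 {ι : Type*} (t : ThomaFock.ThomaParam) (n : ℕ)
    (ε : Fin (2 * n) → Bool) (i : Fin (2 * n) → ι) (k : Fin (2 * n) → ℕ)
    (hW : ThomaFock.IsDyckWord ε i) :
    (∃! π : Equiv.Perm (Fin (2 * n)), ThomaFock.IsNoncrossingPairing ε π) ∧
    ∀ π : Equiv.Perm (Fin (2 * n)), ThomaFock.IsNoncrossingPairing ε π →
      ThomaFock.vacuumExpectation (ThomaFock.wordOp t ε i k) =
        MvPolynomial.aeval (fun m => (ThomaFock.thomaVariable t m : ℂ))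
          (ThomaFock.cycleIndicator (ThomaFock.wordDigraph ε i π)
            (ThomaFock.wordWeight ε k π)) := by
  refine ⟨hW.isDyckPath.existsUnique_pairing, fun π hπ => ?_⟩
  rw [ThomaFock.vacuumExpectation_wordOp t i k hπ, ThomaFock.aeval_cycleIndicator]
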